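/- A Cantor set is a nonempty compact, perfect, nowhere dense set $K\subset\mathbb R$. Write $K_+=K\cap(0,\infty)$ and $K_-=-(K\cap(-\infty,0))$. Call a Cantor set $K$ with $K_+\neq\emptyset$ and $K_-\neq\emptyset$ - a $0$-Cantor set if $\inf K_+=\inf K_-=0$; - a $0^{\times}$-Cantor set if $0\notin K$; - a $0^+_-$-Cantor set if $\inf K_+=0$ and $\inf K_->0$. A gap of $K$ is a connected component of $\mathbb R\setminus K$, and $U^L,U^R,|U|$ denote the left end, the right end and the length of a gap $U$ (with $|U|=\infty$ for the two unbounded gaps). The thickness of $K$ is $$\tau(K)=\inf_{U_1<U_2}\max\left\{\frac{U_2^L-U_1^R}{|U_1|},\frac{U_2^L-U_1^R}{|U_2|}\right\},$$ the infimum being over all pairs of gaps of $K$ with $U_1$ to the left of $U_2$ and at least one of them bounded (a quotient by $\infty$ is $0$). Let $K\cdot L=\{xy: x\in K,\ y\in L\}$. Consider the following four types of pairs $(K,L)$ of Cantor sets: 1. $K$ is a $0$-Cantor set and $L$ is a $0^+_-$-Cantor set; 2. $K$ is a $0$-Cantor set and $L$ is a $0^{\times}$-Cantor set; 3. $K$ is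 a $0^+_-$-Cantor set and $L$ is a $0^{\times}$-Cantor set; 4. $K$ and $L$ are both $0^+_-$-Cantor sets. Theorem. For each of the four types the following hold. (a) If $(K,L)$ is of this type and $2(\tau(K)+1)(\tau(L)+1)\le(\tau(K)\tau(L)-1)^2$, then $K\cdot L$ is a (nondegenerate, closed) interval. (b) If $M,N>0$ are real numbers with $2(M+1)(N+1)>(MN-1)^2$, then there is a pair $(K,L)$ of this type with $\tau(K)=M$ and $\tau(L)=N$ such that $K\cdot L$ is the disjoint union of two (nondegenerate, closed) intervals. -/

import Mathlib

open Set
open scoped Pointwise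

namespace CantorProduct

/-- A Cantor set on the line: nonempty, compact, perfect, nowhere dense. -/
structure IsCantorSet (K : Set ℝ) : Prop where
  nonempty : K.Nonempty
  isCompact : IsCompact K
  perfect : Perfect K
  nowhereDense : IsNowhereDense K

/-- `K₊ = K ∩ (0, ∞)`. -/
def plusPart (K : Set ℝ) : Set ℝ := K ∩ Ioi 0

/-- `K₋ = -(K ∩ (-∞, 0))`, a set of positive numbers. -/
def minusPart (K : Set ℝ) : Set ℝ := -(K ∩ Iio 0)

/-- `0`-Cantor sets: `0` is accumulated from both sides. -/
structure IsZeroCantor (K : Set ℝ) : Prop where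
  isCantorSet : IsCantorSet K
  plus_nonempty : (plusPart K).Nonempty
  minus_nonempty : (minusPart K).Nonempty
  sInf_plus : sInf (plusPart K) = 0
  sInf_minus : sInf (minusPart K) = 0

/-- `0^×`-Cantor sets: there are points on both sides of `0`, which is not in the set. -/
structure IsZeroTimesCantor (K : Set ℝ) : Prop where
  isCantorSet : IsCantorSet K
  plus_nonempty : (plusPart K).Nonempty
  minus_nonempty : (minusPart K).Nonempty
  zero_notMem : (0 : ℝ) ∉ K

/-- `0^+_-`-Cantor sets: there are points on both sides of `0`, which is accumulated from the
right only. -/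
structure IsZeroPlusMinusCantor (K : Set ℝ) : Prop where
  isCantorSet : IsCantorSet K
  plus_nonempty : (plusPart K).Nonempty
  minus_nonempty : (minusPart K).Nonempty
  sInf_plus : sInf (plusPart K) = 0
  sInf_minus : 0 < sInf (minusPart K)

/-- `(a, b)` is a bounded gap of the closed set `K`, i.e. a bounded connected component of the
complement of `K`. The unbounded gaps of a nonempty compact set `K` are `(-∞, inf K)` and
`(sup K, ∞)`. -/
def IsBoundedGap (K : Set ℝ) (a b : ℝ) : Prop :=
  a ∈ K ∧ b ∈ K ∧ a < b ∧ ∀ x ∈ Ioo a b, x ∉ K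

/-- The numbers `max (d / |U₁|) (d / |U₂|)`, where `U₁ < U₂` are gaps of the compact set `K`, at
least one of them bounded, and `d` is the distance from the right end of `U₁` to the left end of
`U₂`. In turn: both gaps are bounded; `U₁ = (-∞, inf K)`; `U₂ = (sup K, ∞)`. The quotient by the
length of an unbounded gap is `d / ∞ = 0`, so that the other quotient is the maximum. -/
def thicknessRatios (K : Set ℝ) : Set ℝ :=
  {r | ∃ a b a' b' : ℝ, IsBoundedGap K a b ∧ IsBoundedGap K a' b' ∧ b < a' ∧
      r = max ((a' - b) / (b - a)) ((a' - b) / (b' - a'))} ∪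
  {r | ∃ a b : ℝ, IsBoundedGap K a b ∧ r = (a - sInf K) / (b - a)} ∪
  {r | ∃ a b : ℝ, IsBoundedGap K a b ∧ r = (sSup K - b) / (b - a)}

/-- The thickness `τ(K)` of a Cantor set `K`. A Cantor set has bounded gaps, so this is the infimum
of a nonempty set of nonnegative numbers. -/
noncomputable def thickness (K : Set ℝ) : ℝ := sInf (thicknessRatios K)

/-- The four types of pairs of Cantor sets. -/
inductive PairType : Type
  | zero_zeroPlusMinus
  | zero_zeroTimes
  | zeroPlusMinus_zeroTimes
  | zeroPlusMinus_zeroPlusMinus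

/-- The pair `(K, L)` of Cantor sets has the given type. -/
def PairType.Holds : PairType → Set ℝ → Set ℝ → Prop
  | .zero_zeroPlusMinus, K, L => IsZeroCantor K ∧ IsZeroPlusMinusCantor L
  | .zero_zeroTimes, K, L => IsZeroCantor K ∧ IsZeroTimesCantor L
  | .zeroPlusMinus_zeroTimes, K, L => IsZeroPlusMinusCantor K ∧ IsZeroTimesCantor L
  | .zeroPlusMinus_zeroPlusMinus, K, L => IsZeroPlusMinusCantor K ∧ IsZeroPlusMinusCantor L

end CantorProduct

/-! Part (a): every nonzero `t` between the extreme products must be attained. Scaling `L` by `1 /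
t` (and reflecting it if `t < 0`) reduces this to solving `x * y = 1`, i.e. to showing that `K`
meets `L⁻¹` on the projective line. This is a Newhouse gap argument. If there is no solution, some
gap `U = (a, b)` of `K` and `V = (c, d)` of `L` are linked; by compactness there is a linked pair of
least total length (`exists_minimal_linked`), and every linked pair can be shortened. Up to
reflecting both sets there are two configurations.

Low (only `a * c` lies below `1`): thickness to the left of `U` and of `V` suffices, as in
Newhouse's lemma, because `M * N > 1` (`exists_shorter_of_low`).

High (only `b * d` lies above `1`): inversion distorts lengths, and `M * N > 1` is not enough.
Minimality on the right bounds the relative gap lengths from below; the hypothesis on `M` and `N`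
turns this into `1 < P * Q`, where `-P` and `-Q` are the points that thickness reaches to the left
of `U` and `V`, beyond `0` (`one_lt_mul_of_ratio_lt`). A shorter linked pair is then found with its
gap of `K` on the negative side (`exists_shorter_of_high`).

Part (b): each set is glued from three very thick blocks, one negative and two nonnegative. Products
of such blocks are intervals, by a one-sided gap lemma. The thickness is decided by the gap between
the two nonnegative blocks, and the product misses an interval just below `1` as soon as three
products of block ends are below `1`. The extremal choice of ends (`exists_params`) meets the same
algebraic inequality as part (a), which makes the bound sharp. -/

namespace CantorProduct

/-! ### Thickness as inequalities between gaps and distances; reflection and affine maps -/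

/-- `K` is a compact set with smallest element `p`, largest element `q`, and thickness at least
`M`. -/
structure ThickHull (K : Set ℝ) (p q M : ℝ) : Prop where
  isCompact : IsCompact K
  isLeast : IsLeast K p
  isGreatest : IsGreatest K q
  left : ∀ a b, IsBoundedGap K a b → M * (b - a) ≤ a - p
  right : ∀ a b, IsBoundedGap K a b → M * (b - a) ≤ q - b
  pair : ∀ a b a' b', IsBoundedGap K a b → IsBoundedGap K a' b' → b ≤ a' →
    M * (b - a) ≤ a' - b ∨ M * (b' - a') ≤ a' - b

theorem IsBoundedGap.neg {K : Set ℝ} {a b : ℝ} (h : IsBoundedGap (-K) a b) :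
    IsBoundedGap K (-b) (-a) := by
  obtain ⟨ha, hb, hab, h⟩ := h
  refine ⟨hb, ha, by linarith, fun x hx hxK => h (-x) ⟨by linarith [hx.2], by linarith [hx.1]⟩ ?_⟩
  simpa using hxK

theorem IsBoundedGap.le_or_le {K : Set ℝ} {a b x : ℝ} (h : IsBoundedGap K a b) (hx : x ∈ K) :
    x ≤ a ∨ b ≤ x := by
  by_contra! hc
  exact h.2.2.2 x hc hx

theorem ThickHull.neg {K : Set ℝ} {p q M : ℝ} (h : ThickHull K p q M) :
    ThickHull (-K) (-q) (-p) M where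
  isCompact := h.isCompact.neg
  isLeast := ⟨by simpa using h.isGreatest.1, fun x hx => by
    have := h.isGreatest.2 hx; linarith⟩
  isGreatest := ⟨by simpa using h.isLeast.1, fun x hx => by
    have := h.isLeast.2 hx; linarith⟩
  left a b hg := by have := h.right _ _ hg.neg; linarith
  right a b hg := by have := h.left _ _ hg.neg; linarith
  pair a b a' b' hg hg' hb := by
    have := h.pair _ _ _ _ hg'.neg hg.neg (by linarith)
    rcases this with h1 | h1
    · right; linarith
    · left; linarith

/-- The image of `K` under an increasing affine map. -/
def affineCopy (s r : ℝ) (K : Set ℝ) : Set ℝ := (fun x => s * x + r) '' K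

theorem mem_affineCopy {s r x : ℝ} (hs : 0 < s) {K : Set ℝ} :
    x ∈ affineCopy s r K ↔ (x - r) / s ∈ K := by
  constructor
  · rintro ⟨y, hy, rfl⟩
    have : (s * y + r - r) / s = y := by field_simp; ring
    simpa only [this] using hy
  · intro h
    exact ⟨_, h, by field_simp; ring⟩

theorem IsBoundedGap.of_affineCopy {K : Set ℝ} {s r a b : ℝ} (hs : 0 < s)
    (h : IsBoundedGap (affineCopy s r K) a b) :
    IsBoundedGap K ((a - r) / s) ((b - r) / s) := by
  obtain ⟨ha, hb, hab, h⟩ := h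
  refine ⟨(mem_affineCopy hs).1 ha, (mem_affineCopy hs).1 hb, by gcongr, fun x hx hxK =>
    h (s * x + r) ⟨?_, ?_⟩ ⟨x, hxK, rfl⟩⟩
  · have := (div_lt_iff₀ hs).1 hx.1; linarith
  · have := (lt_div_iff₀ hs).1 hx.2; linarith

theorem ThickHull.affineCopy {K : Set ℝ} {p q M s r : ℝ} (h : ThickHull K p q M) (hs : 0 < s) :
    ThickHull (affineCopy s r K) (s * p + r) (s * q + r) M := by
  have key : ∀ x, s * ((x - r) / s) = x - r := fun x => by field_simp
  refine ⟨h.isCompact.image (by fun_prop), ⟨⟨p, h.isLeast.1, rfl⟩, ?_⟩,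
    ⟨⟨q, h.isGreatest.1, rfl⟩, ?_⟩, ?_, ?_, ?_⟩
  · rintro _ ⟨y, hy, rfl⟩
    have := h.isLeast.2 hy
    simp only; gcongr
  · rintro _ ⟨y, hy, rfl⟩
    have := h.isGreatest.2 hy
    simp only; gcongr
  · intro a b hg
    have := mul_le_mul_of_nonneg_left (h.left _ _ (hg.of_affineCopy hs)) hs.le
    linear_combination this - M * (key b - key a) + key a
  · intro a b hg
    have := mul_le_mul_of_nonneg_left (h.right _ _ (hg.of_affineCopy hs)) hs.le
    linear_combination this - M * (key b - key a) - key b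
  · intro a b a' b' hg hg' hb
    rcases h.pair _ _ _ _ (hg.of_affineCopy hs) (hg'.of_affineCopy hs) (by gcongr) with h1 | h1
    · have := mul_le_mul_of_nonneg_left h1 hs.le
      left; linear_combination this - M * (key b - key a) + key a' - key b
    · have := mul_le_mul_of_nonneg_left h1 hs.le
      right; linear_combination this - M * (key b' - key a') + key a' - key b

theorem exists_gap {K : Set ℝ} (hK : IsCompact K) {x y z : ℝ} (hx : x ∈ K) (hy : y ∈ K)
    (hz : z ∉ K) (hxz : x ≤ z) (hzy : z ≤ y) :
    ∃ a b, IsBoundedGap K a b ∧ x ≤ a ∧ a < z ∧ z < b ∧ b ≤ y := by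
  obtain ⟨a, ⟨haK, haz⟩, ha⟩ := (hK.inter_right isClosed_Iic).exists_isGreatest ⟨x, hx, hxz⟩
  obtain ⟨b, ⟨hbK, hbz⟩, hb⟩ := (hK.inter_right isClosed_Ici).exists_isLeast ⟨y, hy, hzy⟩
  have h1 : a < z := lt_of_le_of_ne haz (by rintro rfl; exact hz haK)
  have h2 : z < b := lt_of_le_of_ne hbz (by rintro rfl; exact hz hbK)
  refine ⟨a, b, ⟨haK, hbK, h1.trans h2, fun w hw hwK => ?_⟩, ha ⟨hx, hxz⟩, h1, h2, hb ⟨hy, hzy⟩⟩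
  rcases le_total w z with h | h
  · exact absurd (ha ⟨hwK, h⟩) (not_le.2 hw.1)
  · exact absurd (hb ⟨hwK, h⟩) (not_le.2 hw.2)

/-- The other gap ends closer than `M * (b - a)` to this one, so the pair condition can only hold
through the other gap's own length. -/
theorem ThickHull.shorter_left {K : Set ℝ} {p q M a b a' b' : ℝ} (h : ThickHull K p q M)
    (hM : 0 < M) (hg : IsBoundedGap K a b) (hg' : IsBoundedGap K a' b') (hb : b' ≤ a)
    (hlt : a - M * (b - a) < b') : b' - a' < b - a := by
  rcases h.pair _ _ _ _ hg' hg hb with h1 | h1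
  · exact lt_of_mul_lt_mul_left (by linarith : M * (b' - a') < M * (b - a)) hM.le
  · linarith

theorem ThickHull.shorter_right {K : Set ℝ} {p q M a b a' b' : ℝ} (h : ThickHull K p q M)
    (hM : 0 < M) (hg : IsBoundedGap K a b) (hg' : IsBoundedGap K a' b') (hb : b ≤ a')
    (hlt : a' < b + M * (b - a)) : b' - a' < b - a := by
  rcases h.pair _ _ _ _ hg hg' hb with h1 | h1
  · linarith
  · exact lt_of_mul_lt_mul_left (by linarith : M * (b' - a') < M * (b - a)) hM.le

/-! ### Linked pairs of gaps and minimal ones -/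

/-- A gap `U` of `K` and a gap `V` of `L` such that the end points of `U` separate those of `V⁻¹`
on the projective line. -/
def Linked (K L : Set ℝ) (a b c d : ℝ) : Prop :=
  IsBoundedGap K a b ∧ IsBoundedGap L c d ∧
    (a * c - 1) * (a * d - 1) * ((b * c - 1) * (b * d - 1)) < 0

theorem Linked.swap {K L : Set ℝ} {a b c d : ℝ} (h : Linked K L a b c d) :
    Linked L K c d a b := by
  refine ⟨h.2.1, h.1, lt_of_eq_of_lt ?_ h.2.2⟩
  ring

theorem Linked.neg {K L : Set ℝ} {a b c d : ℝ} (h : Linked (-K) (-L) a b c d) :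
    Linked K L (-b) (-a) (-d) (-c) := by
  refine ⟨h.1.neg, h.2.1.neg, lt_of_eq_of_lt ?_ h.2.2⟩
  ring

/-- A negative product means that exactly one of the four products lies alone on its side of `1`. It
cannot be `a * d` or `b * c`: the orders `a < b` and `c < d` would then force incompatible signs on
the end points. -/
theorem Linked.cases {K L : Set ℝ} {a b c d : ℝ} (h : Linked K L a b c d) :
    (a * c < 1 ∧ a * d < 1 ∧ b * c < 1 ∧ 1 < b * d) ∨
    (a * c < 1 ∧ 1 < a * d ∧ 1 < b * c ∧ 1 < b * d) ∨
    (1 < a * c ∧ a * d < 1 ∧ b * c < 1 ∧ b * d < 1) ∨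
    (1 < a * c ∧ 1 < a * d ∧ 1 < b * c ∧ b * d < 1) := by
  obtain ⟨⟨-, -, hab, -⟩, ⟨-, -, hcd, -⟩, h⟩ := h
  have one : ∀ a b c d : ℝ, a < b → c < d → b * d < 1 → a * c < 1 → 1 < a * d → False := by
    intro a b c d hab hcd h1 h2 h3
    have hd : d < 0 := by by_contra!; nlinarith
    have ha : a < 0 := by by_contra!; nlinarith
    nlinarith
  have three : ∀ a b c d : ℝ, a < b → c < d → 1 < b * d → 1 < a * c → 1 < b * c → a * d < 1 →
      False := by
    intro a b c d hab hcd h1 h2 h3 h4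
    have hd : 0 < d := by by_contra!; nlinarith
    have ha : a < 0 := by by_contra!; nlinarith
    have hc : c < 0 := by by_contra!; nlinarith
    have hb : 0 < b := by by_contra!; nlinarith
    nlinarith
  have hne : ∀ x y z w : ℝ, (x - 1) * (y - 1) * ((z - 1) * (w - 1)) < 0 →
      (x < 1 ∨ 1 < x) ∧ (y < 1 ∨ 1 < y) ∧ (z < 1 ∨ 1 < z) ∧ (w < 1 ∨ 1 < w) := by
    intro x y z w h
    refine ⟨lt_or_gt_of_ne ?_, lt_or_gt_of_ne ?_, lt_or_gt_of_ne ?_, lt_or_gt_of_ne ?_⟩ <;>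
    · rintro rfl; simp at h
  have pp : ∀ {x y : ℝ}, 1 < x → 1 < y → 0 < (x - 1) * (y - 1) := fun hx hy =>
    mul_pos (sub_pos.2 hx) (sub_pos.2 hy)
  have nn : ∀ {x y : ℝ}, x < 1 → y < 1 → 0 < (x - 1) * (y - 1) := fun hx hy =>
    mul_pos_of_neg_of_neg (sub_neg.2 hx) (sub_neg.2 hy)
  have pn : ∀ {x y : ℝ}, 1 < x → y < 1 → (x - 1) * (y - 1) < 0 := fun hx hy =>
    mul_neg_of_pos_of_neg (sub_pos.2 hx) (sub_neg.2 hy)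
  have np : ∀ {x y : ℝ}, x < 1 → 1 < y → (x - 1) * (y - 1) < 0 := fun hx hy =>
    mul_neg_of_neg_of_pos (sub_neg.2 hx) (sub_pos.2 hy)
  have one' := one c d a b hcd hab
  have three' := three c d a b hcd hab
  rw [mul_comm c, mul_comm d, mul_comm c] at one'
  rw [mul_comm c, mul_comm d, mul_comm d, mul_comm c] at three'
  obtain ⟨h1 | h1, h2 | h2, h3 | h3, h4 | h4⟩ := hne _ _ _ _ h
  · exact absurd h (mul_pos (nn h1 h2) (nn h3 h4)).not_gt
  · exact .inl ⟨h1, h2, h3, h4⟩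
  · exact (one' h4 h1 h3).elim
  · exact absurd h (mul_pos (nn h1 h2) (pp h3 h4)).not_gt
  · exact (one _ _ _ _ hab hcd h4 h1 h2).elim
  · exact absurd h (mul_pos_of_neg_of_neg (np h1 h2) (np h3 h4)).not_gt
  · exact absurd h (mul_pos_of_neg_of_neg (np h1 h2) (pn h3 h4)).not_gt
  · exact .inr (.inl ⟨h1, h2, h3, h4⟩)
  · exact .inr (.inr (.inl ⟨h1, h2, h3, h4⟩))
  · exact absurd h (mul_pos_of_neg_of_neg (pn h1 h2) (np h3 h4)).not_gt
  · exact absurd h (mul_pos_of_neg_of_neg (pn h1 h2) (pn h3 h4)).not_gt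
  · exact (three _ _ _ _ hab hcd h4 h1 h3 h2).elim
  · exact absurd h (mul_pos (pp h1 h2) (nn h3 h4)).not_gt
  · exact (three' h4 h1 h2 h3).elim
  · exact .inr (.inr (.inr ⟨h1, h2, h3, h4⟩))
  · exact absurd h (mul_pos (pp h1 h2) (pp h3 h4)).not_gt

/-- Weakening all strict inequalities gives a compact set of quadruples, so the total length has a
minimiser there. It is a genuine linked pair: no factor vanishes because no product equals `1`, and
a gap of length zero would make the product of the factors a square. -/
theorem exists_minimal_linked {K L : Set ℝ} (hK : IsCompact K) (hL : IsCompact L)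
    (hKL : ∀ x ∈ K, ∀ y ∈ L, x * y ≠ 1) (hex : ∃ a b c d, Linked K L a b c d) :
    ∃ a b c d, Linked K L a b c d ∧ ∀ a' b' c' d', Linked K L a' b' c' d' →
      (b - a) + (d - c) ≤ (b' - a') + (d' - c') := by
  have hcl : ∀ S : Set ℝ, IsClosed {z : ℝ × ℝ | ∀ x ∈ S, x ≤ z.1 ∨ z.2 ≤ x} := by
    intro S
    simp only [ofPred_forall, ofPred_or]
    exact isClosed_iInter fun x => isClosed_iInter fun _ =>
      (isClosed_le continuous_const continuous_fst).union
        (isClosed_le continuous_snd continuous_const)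
  let S : Set ((ℝ × ℝ) × (ℝ × ℝ)) := ((K ×ˢ K) ×ˢ (L ×ˢ L)) ∩
    ((({z | z.1.1 ≤ z.1.2} ∩ {z | z.2.1 ≤ z.2.2}) ∩
    (Prod.fst ⁻¹' {z : ℝ × ℝ | ∀ x ∈ K, x ≤ z.1 ∨ z.2 ≤ x} ∩
    Prod.snd ⁻¹' {z : ℝ × ℝ | ∀ x ∈ L, x ≤ z.1 ∨ z.2 ≤ x})) ∩
    {z | (z.1.1 * z.2.1 - 1) * (z.1.1 * z.2.2 - 1) *
      ((z.1.2 * z.2.1 - 1) * (z.1.2 * z.2.2 - 1)) ≤ 0})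
  have hmem : ∀ a b c d, Linked K L a b c d → ((a, b), (c, d)) ∈ S := fun a b c d h =>
    ⟨⟨⟨h.1.1, h.1.2.1⟩, ⟨h.2.1.1, h.2.1.2.1⟩⟩, ⟨⟨⟨h.1.2.2.1.le, h.2.1.2.2.1.le⟩,
      ⟨fun x hx => h.1.le_or_le hx, fun x hx => h.2.1.le_or_le hx⟩⟩, h.2.2.le⟩⟩
  have hS : IsCompact S := by
    refine ((hK.prod hK).prod (hL.prod hL)).inter_right (IsClosed.inter (IsClosed.inter
      (IsClosed.inter ?_ ?_) (IsClosed.inter ?_ ?_)) ?_)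
    · exact isClosed_le (by fun_prop) (by fun_prop)
    · exact isClosed_le (by fun_prop) (by fun_prop)
    · exact (hcl K).preimage continuous_fst
    · exact (hcl L).preimage continuous_snd
    · exact isClosed_le (by fun_prop) (by fun_prop)
  obtain ⟨a₀, b₀, c₀, d₀, h₀⟩ := hex
  obtain ⟨⟨⟨a, b⟩, c, d⟩, hz, hmin⟩ := hS.exists_isMinOn ⟨_, hmem _ _ _ _ h₀⟩
    (f := fun z => (z.1.2 - z.1.1) + (z.2.2 - z.2.1)) (by fun_prop)
  obtain ⟨⟨⟨ha, hb⟩, ⟨hc, hd⟩⟩, ⟨⟨⟨hab, hcd⟩, ⟨hgK, hgL⟩⟩, hprod⟩⟩ := hz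
  simp only [mem_ofPred_eq, mem_preimage] at ha hb hc hd hab hcd hgK hgL hprod
  have h1 := sub_ne_zero.2 (hKL a ha c hc)
  have h2 := sub_ne_zero.2 (hKL a ha d hd)
  have h3 := sub_ne_zero.2 (hKL b hb c hc)
  have h4 := sub_ne_zero.2 (hKL b hb d hd)
  have hlt := lt_of_le_of_ne hprod (mul_ne_zero (mul_ne_zero h1 h2) (mul_ne_zero h3 h4))
  refine ⟨a, b, c, d, ⟨⟨ha, hb, lt_of_le_of_ne hab ?_, fun x hx hxK => ?_⟩,
    ⟨hc, hd, lt_of_le_of_ne hcd ?_, fun x hx hxL => ?_⟩, hlt⟩,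
    fun a' b' c' d' h' => hmin (hmem _ _ _ _ h')⟩
  · rintro rfl
    nlinarith [sq_nonneg ((a * c - 1) * (a * d - 1))]
  · rcases hgK x hxK with h | h
    · exact absurd hx.1 (not_lt.2 h)
    · exact absurd hx.2 (not_lt.2 h)
  · rintro rfl
    nlinarith [sq_nonneg ((a * c - 1) * (b * c - 1))]
  · rcases hgL x hxL with h | h
    · exact absurd hx.1 (not_lt.2 h)
    · exact absurd hx.2 (not_lt.2 h)

theorem linked_iff_of_signs {K L : Set ℝ} {a b c d : ℝ} (hg : IsBoundedGap K a b)
    (hg' : IsBoundedGap L c d)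
    (h : (a * c < 1 ∧ a * d < 1 ∧ b * c < 1 ∧ 1 < b * d) ∨
      (a * c < 1 ∧ 1 < a * d ∧ 1 < b * c ∧ 1 < b * d) ∨
      (1 < a * c ∧ a * d < 1 ∧ b * c < 1 ∧ b * d < 1)) : Linked K L a b c d := by
  refine ⟨hg, hg', ?_⟩
  rcases h with ⟨h1, h2, h3, h4⟩ | ⟨h1, h2, h3, h4⟩ | ⟨h1, h2, h3, h4⟩
  · exact mul_neg_of_pos_of_neg (mul_pos_of_neg_of_neg (sub_neg.2 h1) (sub_neg.2 h2))
      (mul_neg_of_neg_of_pos (sub_neg.2 h3) (sub_pos.2 h4))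
  · exact mul_neg_of_neg_of_pos (mul_neg_of_neg_of_pos (sub_neg.2 h1) (sub_pos.2 h2))
      (mul_pos (sub_pos.2 h3) (sub_pos.2 h4))
  · exact mul_neg_of_neg_of_pos (mul_neg_of_pos_of_neg (sub_pos.2 h1) (sub_neg.2 h2))
      (mul_pos_of_neg_of_neg (sub_neg.2 h3) (sub_neg.2 h4))

/-! ### Shortening linked pairs, and the two gap lemmas -/

section
variable {K L : Set ℝ} {p q M u v N a b c d : ℝ}

theorem inv_notMem (hKL : ∀ x ∈ K, ∀ y ∈ L, x * y ≠ 1) {y : ℝ} (hy : y ∈ L) (h0 : y ≠ 0) :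
    y⁻¹ ∉ K := fun h => hKL _ h y hy (inv_mul_cancel₀ h0)

/-- The point `1 / d` is missing from `K` and lies within `M * (b - a)` to the left of `a`. The gap
of `K` around it is shorter than `(a, b)` and is linked with the same gap of `L`. -/
theorem exists_shorter_of_low_left (hK : ThickHull K p q M) (hM : 0 < M)
    (hKL : ∀ x ∈ K, ∀ y ∈ L, x * y ≠ 1)
    (hg : IsBoundedGap K a b) (hg' : IsBoundedGap L c d)
    (h1 : a * c < 1) (h2 : 1 < a * d) (hc : 0 < c) (hd : 0 < d)
    (h : (a - M * (b - a)) * d ≤ 1) :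
    ∃ a' b', Linked K L a' b' c d ∧ b' - a' < b - a := by
  have hz : d⁻¹ ∉ K := inv_notMem hKL hg'.2.1 hd.ne'
  have h3 : a - M * (b - a) ≤ d⁻¹ := by rwa [← one_div, le_div_iff₀ hd]
  have h4 : d⁻¹ < a := by rwa [← one_div, div_lt_iff₀ hd]
  obtain ⟨a', b', hg1, -, ha', hb', hb'a⟩ := exists_gap hK.isCompact hK.isLeast.1 hg.1 hz
    (by linarith [hK.left _ _ hg]) h4.le
  have h5 : a' * d < 1 := by rwa [← lt_div_iff₀ hd, one_div]
  have h6 : 1 < b' * d := by rwa [← div_lt_iff₀ hd, one_div]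
  have h7 : b' * c < 1 := by nlinarith
  refine ⟨a', b', linked_iff_of_signs hg1 hg' (.inl ⟨?_, h5, h7, h6⟩),
    hK.shorter_left hM hg hg1 hb'a (by linarith)⟩
  nlinarith [hg1.2.2.1]

/-- If neither gap can be replaced, then `M * (b - a) * d < a * (d - c)` and `N * (d - c) * b < c *
(b - a)`. Multiplying gives `M * N * (b * d) < a * c`, impossible for `M * N > 1`. -/
theorem exists_shorter_of_low (hK : ThickHull K p q M) (hL : ThickHull L u v N)
    (hM : 0 < M) (hN : 0 < N) (hMN : 1 < M * N)
    (hKL : ∀ x ∈ K, ∀ y ∈ L, x * y ≠ 1)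
    (hg : IsBoundedGap K a b) (hg' : IsBoundedGap L c d)
    (h1 : a * c < 1) (h2 : 1 < a * d) (h3 : 1 < b * c) (h4 : 1 < b * d) :
    ∃ a' b' c' d', Linked K L a' b' c' d' ∧ (b' - a') + (d' - c') < (b - a) + (d - c) := by
  have hab := hg.2.2.1
  have hcd := hg'.2.2.1
  have ha : 0 < a := by by_contra!; nlinarith
  have hc : 0 < c := by by_contra!; nlinarith
  by_cases h5 : (a - M * (b - a)) * d ≤ 1
  · obtain ⟨a', b', h, hlt⟩ :=
      exists_shorter_of_low_left hK hM hKL hg hg' h1 h2 hc (hc.trans hcd) h5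
    exact ⟨a', b', c, d, h, by linarith⟩
  by_cases h6 : (c - N * (d - c)) * b ≤ 1
  · obtain ⟨c', d', h, hlt⟩ :=
      exists_shorter_of_low_left hL hN (fun x hx y hy => by rw [mul_comm]; exact hKL y hy x hx)
        hg' hg (by linarith) (by linarith) ha (ha.trans hab) h6
    exact ⟨a, b, c', d', h.swap, by linarith⟩
  exfalso
  push Not at h5 h6
  have h7 : M * (b - a) * d < a * (d - c) := by nlinarith
  have h8 : N * (d - c) * b < c * (b - a) := by nlinarith
  have h9 := mul_lt_mul'' h7 h8 (mul_nonneg (mul_nonneg hM.le (sub_pos.2 hab).le) (hc.trans hcd).le)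
    (mul_nonneg (mul_nonneg hN.le (sub_pos.2 hcd).le) (ha.trans hab).le)
  have h10 : 0 < (b - a) * (d - c) := mul_pos (sub_pos.2 hab) (sub_pos.2 hcd)
  have h11 : (M * N * (b * d)) < a * c := by
    refine lt_of_mul_lt_mul_right ?_ h10.le
    linear_combination h9
  nlinarith

/-- Otherwise `1 / c`, which is missing from `K`, lies within `M * (b - a)` to the right of `b`, and
its gap is a shorter partner for `(c, d)`. -/
theorem lt_one_of_minimal_high (hK : ThickHull K p q M) (hM : 0 < M)
    (hKL : ∀ x ∈ K, ∀ y ∈ L, x * y ≠ 1)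
    (hg : IsBoundedGap K a b) (hg' : IsBoundedGap L c d)
    (h2 : a * d < 1) (h3 : b * c < 1) (h4 : 1 < b * d)
    (hmin : ∀ a' b', Linked K L a' b' c d → b - a ≤ b' - a') :
    (b + M * (b - a)) * c < 1 := by
  have hab := hg.2.2.1
  have hcd := hg'.2.2.1
  have hd : 0 < d := by by_contra!; nlinarith
  have hb : 0 < b := by by_contra!; nlinarith
  have hB : 0 < b + M * (b - a) := by have := sub_pos.2 hab; positivity
  by_contra! h
  have hc : 0 < c := by by_contra!; nlinarith
  have hz : c⁻¹ ∉ K := inv_notMem hKL hg'.1 hc.ne'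
  have h6 : c⁻¹ ≤ b + M * (b - a) := by rwa [← one_div, div_le_iff₀ hc]
  have h5 : b < c⁻¹ := by rwa [← one_div, lt_div_iff₀ hc]
  obtain ⟨a', b', hg1, hba', ha', hb', -⟩ := exists_gap hK.isCompact hg.2.1 hK.isGreatest.1 hz
    h5.le (by linarith [hK.right _ _ hg])
  have h7 : a' * c < 1 := by rwa [← lt_div_iff₀ hc, one_div]
  have h8 : 1 < b' * c := by rwa [← div_lt_iff₀ hc, one_div]
  have h9 : 1 < a' * d := by nlinarith
  have h10 : 1 < b' * d := by nlinarith [hg1.2.2.1]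
  exact absurd (hmin a' b' (linked_iff_of_signs hg1 hg' (.inr (.inl ⟨h7, h9, h8, h10⟩))))
    (not_le.2 (hK.shorter_right hM hg hg1 hba' (by linarith)))

/-- The ratios `x = (b - a) / b` and `y = (d - c) / d` satisfy `M x < y + M x y`. -/
theorem ratio_lt (hb : 0 < b) (hd : 0 < d) (h4 : 1 < b * d) (h : (b + M * (b - a)) * c < 1) :
    M * ((b - a) / b) < (d - c) / d + M * ((b - a) / b) * ((d - c) / d) := by
  have h1 : (1 + M * ((b - a) / b)) * (1 - (d - c) / d) * (b * d) = (b + M * (b - a)) * c := by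
    field_simp; ring
  have h2 : (1 + M * ((b - a) / b)) * (1 - (d - c) / d) < 1 := by
    by_contra! hc
    nlinarith
  linarith

/-- This is where the hypothesis on `M` and `N` enters. A positive combination of the two ratio
inequalities yields `(M + 1) * x + (N + 1) * y < (M + 1) * (N + 1) * (x * y)`, a rearrangement of
the last claim; the required comparison of the `x * y` coefficients is exactly `hc`. -/
theorem one_lt_mul_of_ratio_lt {x y : ℝ} (hM : 0 < M) (hN : 0 < N) (hMN : 1 < M * N)
    (hc : 2 * (M + 1) * (N + 1) ≤ (M * N - 1) ^ 2) (hx : 0 < x) (hy : 0 < y)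
    (h1 : M * x < y + M * x * y) (h2 : N * y < x + N * y * x) :
    0 < (M + 1) * x - 1 ∧ 0 < (N + 1) * y - 1 ∧
      1 < ((M + 1) * x - 1) * ((N + 1) * y - 1) := by
  have hxy : 0 < x * y := mul_pos hx hy
  have k : 0 < M * N - 1 := by linarith
  -- The multipliers are chosen so that the linear part becomes `(M * N - 1) * ((N + 1) * y + (M +
  -- 1) * x)`.
  have e1 : (M * N + 2 * M + 1) * (N * y - x - N * (x * y)) +
      (M * N + 2 * N + 1) * (M * x - y - M * (x * y)) < 0 := by
    have : 0 < M * N + 2 * M + 1 := by positivity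
    have : 0 < M * N + 2 * N + 1 := by positivity
    nlinarith
  have e2 : (M * N - 1) * ((N + 1) * y + (M + 1) * x) <
      (M * N - 1) * ((M + 1) * (N + 1) * (x * y)) := by
    have : ((M * N + 2 * M + 1) * N + (M * N + 2 * N + 1) * M) * (x * y) ≤
        (M * N - 1) * ((M + 1) * (N + 1)) * (x * y) := by
      apply mul_le_mul_of_nonneg_right _ hxy.le
      nlinarith
    linear_combination e1 + this
  have e3 := lt_of_mul_lt_mul_left e2 k.le
  have e4 : 0 < (M + 1) * x - 1 := by
    have : (N + 1) * y * 1 < (N + 1) * y * ((M + 1) * x) := by nlinarith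
    have := lt_of_mul_lt_mul_left this (by positivity)
    linarith
  have e5 : 0 < (N + 1) * y - 1 := by
    have : (M + 1) * x * 1 < (M + 1) * x * ((N + 1) * y) := by nlinarith
    have := lt_of_mul_lt_mul_left this (by positivity)
    linarith
  exact ⟨e4, e5, by linarith⟩

/-- With `P = M * (b - a) - a` and `Q = N * (d - c) - c`, minimality would give `P, Q > 0` and `P *
Q > 1`. So the reciprocal of a point of `L` at or below `-Q` lies in `(-P, 0)`. The gap of `K`
around it stays left of `0 ∈ K`, is shorter than `(a, b)`, and has a partner in `L` no longer than
`(c, d)`. -/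
theorem exists_shorter_of_high (hK : ThickHull K p q M) (hL : ThickHull L u v N)
    (hM : 0 < M) (hN : 0 < N) (hMN : 1 < M * N)
    (hc : 2 * (M + 1) * (N + 1) ≤ (M * N - 1) ^ 2) (h0 : (0 : ℝ) ∈ K)
    (hKL : ∀ x ∈ K, ∀ y ∈ L, x * y ≠ 1)
    (hg : IsBoundedGap K a b) (hg' : IsBoundedGap L c d)
    (h2 : a * d < 1) (h3 : b * c < 1) (h4 : 1 < b * d) :
    ∃ a' b' c' d', Linked K L a' b' c' d' ∧ (b' - a') + (d' - c') < (b - a) + (d - c) := by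
  by_contra! hmin
  have hab := hg.2.2.1
  have hcd := hg'.2.2.1
  have hd : 0 < d := by by_contra!; nlinarith
  have hb : 0 < b := by by_contra!; nlinarith
  have h5 := lt_one_of_minimal_high hK hM hKL hg hg' h2 h3 h4 fun a' b' h => by
    linarith [hmin _ _ _ _ h]
  have h6 := lt_one_of_minimal_high hL hN
    (fun x hx y hy => by rw [mul_comm]; exact hKL y hy x hx) hg' hg
    (by linarith) (by linarith) (by linarith : 1 < d * b) fun c' d' h => by
    linarith [hmin _ _ _ _ h.swap]
  obtain ⟨hx, hy, hxy⟩ := one_lt_mul_of_ratio_lt hM hN hMN hc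
    (div_pos (sub_pos.2 hab) hb) (div_pos (sub_pos.2 hcd) hd)
    (ratio_lt hb hd h4 h5) (ratio_lt hd hb (by linarith) h6)
  have eP : ((M + 1) * ((b - a) / b) - 1) * b = M * (b - a) - a := by field_simp; ring
  have eQ : ((N + 1) * ((d - c) / d) - 1) * d = N * (d - c) - c := by field_simp; ring
  have hP : 0 < M * (b - a) - a := eP ▸ mul_pos hx hb
  have hQ : 0 < N * (d - c) - c := eQ ▸ mul_pos hy hd
  have hPQ : 1 < (M * (b - a) - a) * (N * (d - c) - c) := by
    rw [← eP, ← eQ]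
    nlinarith
  have ha : 0 ≤ a := by
    rcases hg.le_or_le h0 with h | h
    · exact h
    · linarith
  -- Taking the last point of `L` up to `-Q` ensures that a gap of `L` to the right of `y` ends
  -- beyond `-Q`, which `shorter_left` needs.
  obtain ⟨y, ⟨hyL, hyQ : y ≤ c - N * (d - c)⟩, hy1⟩ :=
    (hL.isCompact.inter_right (isClosed_Iic (a := c - N * (d - c)))).exists_isGreatest
      ⟨u, hL.isLeast.1, by have := hL.left _ _ hg'; simp only [mem_Iic]; linarith⟩
  have hyneg : y < 0 := by linarith
  have hyc : y ≤ c := by nlinarith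
  have hyd : y ≤ d := hyc.trans hcd.le
  have hz : y⁻¹ ∉ K := inv_notMem hKL hyL hyneg.ne
  have hz0 : y⁻¹ < 0 := inv_lt_zero.2 hyneg
  have hzP : a - M * (b - a) < y⁻¹ := by
    rw [← one_div, lt_div_iff_of_neg hyneg]
    nlinarith
  obtain ⟨a', b', hg1, -, ha', hb', hb'0⟩ := exists_gap hK.isCompact hK.isLeast.1 h0 hz
    (by linarith [hK.left _ _ hg]) hz0.le
  have hs := hK.shorter_left hM hg hg1 (hb'0.trans ha) (by linarith)
  have e1 : 1 < a' * y := by rwa [← lt_div_iff_of_neg hyneg, one_div]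
  have e2 : b' * y < 1 := by rwa [← div_lt_iff_of_neg hyneg, one_div]
  have ha'0 : a' < 0 := ha'.trans hz0
  -- Either `1 / a'` lies between `y` and `c`, and its gap in `L` is the new partner, or `(c, d)`
  -- itself is still linked with `(a', b')`.
  rcases lt_or_gt_of_ne (hKL a' hg1.1 c hg'.1) with e3 | e3
  · have hz' : a'⁻¹ ∉ L := fun h => hKL a' hg1.1 _ h (mul_inv_cancel₀ ha'0.ne)
    have f1 : y < a'⁻¹ := by rw [← one_div, lt_div_iff_of_neg ha'0]; linarith
    have f2 : a'⁻¹ < c := by rw [← one_div, div_lt_iff_of_neg ha'0]; linarith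
    obtain ⟨c', d', hg2, hyc', hc', hd', hd'c⟩ :=
      exists_gap hL.isCompact hyL hg'.1 hz' f1.le f2.le
    have hd'Q : c - N * (d - c) < d' := by
      by_contra! hcon
      exact absurd (hy1 ⟨hg2.2.1, hcon⟩) (not_le.2 (f1.trans hd'))
    have hs' := hL.shorter_left hN hg' hg2 hd'c hd'Q
    have g1 : 1 < a' * c' := by
      rw [← one_div, lt_div_iff_of_neg ha'0] at hc'; linarith
    have g2 : a' * d' < 1 := by
      rw [← one_div, div_lt_iff_of_neg ha'0] at hd'; linarith
    have g3 : b' * c' < 1 := (mul_le_mul_of_nonpos_left hyc' hb'0).trans_lt e2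
    have g4 : b' * d' < 1 :=
      (mul_le_mul_of_nonpos_left (hyc'.trans hg2.2.2.1.le) hb'0).trans_lt e2
    linarith [hmin _ _ _ _ (linked_iff_of_signs hg1 hg2 (.inr (.inr ⟨g1, g2, g3, g4⟩)))]
  · have g2 : a' * d < 1 := (mul_neg_of_neg_of_pos ha'0 hd).trans one_pos
    have g3 : b' * c < 1 := (mul_le_mul_of_nonpos_left hyc hb'0).trans_lt e2
    have g4 : b' * d < 1 := (mul_nonpos_of_nonpos_of_nonneg hb'0 hd.le).trans_lt one_pos
    linarith [hmin _ _ _ _ (linked_iff_of_signs hg1 hg' (.inr (.inr ⟨e3, g2, g3, g4⟩)))]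

/-- The gap lemma for products of sets on both sides of `0`. -/
theorem exists_mul_eq_one (hK : ThickHull K p q M) (hL : ThickHull L u v N)
    (hM : 0 < M) (hN : 0 < N) (hMN : 1 < M * N)
    (hc : 2 * (M + 1) * (N + 1) ≤ (M * N - 1) ^ 2) (h0 : (0 : ℝ) ∈ K)
    (hneg : ∃ y ∈ L, y < 0) (hpos : ∃ y ∈ L, 0 < y) (hgt : ∃ x ∈ K, ∃ y ∈ L, 1 < x * y) :
    ∃ x ∈ K, ∃ y ∈ L, x * y = 1 := by
  by_contra! hKL
  have hKL' : ∀ x ∈ -K, ∀ y ∈ -L, x * y ≠ 1 := fun x hx y hy => by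
    simpa using hKL _ hx _ hy
  -- The gap `(a, b)` of `K` contains `1 / y`, between `0` and `x`; the gap of `L` contains `1 / b`,
  -- between a negative point and `y`.
  have start : ∀ {K L : Set ℝ}, IsCompact K → IsCompact L → (∀ x ∈ K, ∀ y ∈ L, x * y ≠ 1) →
      (0 : ℝ) ∈ K → (∃ y ∈ L, y < 0) → ∀ x ∈ K, ∀ y ∈ L, 0 < y → 1 < x * y →
      ∃ a b c d, Linked K L a b c d := by
    intro K L hK hL hKL h0 ⟨w, hwL, hw⟩ x hx y hy hy0 hxy
    have hz : y⁻¹ ∉ K := inv_notMem hKL hy hy0.ne'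
    have hx1 : y⁻¹ < x := by rwa [← one_div, div_lt_iff₀ hy0]
    obtain ⟨a, b, hg, ha, ha', hb, -⟩ :=
      exists_gap hK h0 hx hz (inv_nonneg.2 hy0.le) hx1.le
    have hb0 : 0 < b := (inv_pos.2 hy0).trans hb
    have h1 : a * y < 1 := by rwa [← lt_div_iff₀ hy0, one_div]
    have h2 : 1 < b * y := by rwa [← div_lt_iff₀ hy0, one_div]
    have hz' : b⁻¹ ∉ L := fun h => hKL b hg.2.1 _ h (mul_inv_cancel₀ hb0.ne')
    have hyb : b⁻¹ < y := by rw [← one_div, div_lt_iff₀ hb0]; linarith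
    obtain ⟨c, d, hg', -, hc, hd, hdy⟩ := exists_gap hL hwL hy hz'
      (hw.le.trans (inv_nonneg.2 hb0.le)) hyb.le
    have h3 : b * c < 1 := by rw [← one_div, lt_div_iff₀ hb0] at hc; linarith
    have h4 : 1 < b * d := by rw [← one_div, div_lt_iff₀ hb0] at hd; linarith
    have h5 : a * d < 1 := by nlinarith
    have h6 : a * c < 1 := by nlinarith [hg'.2.2.1]
    exact ⟨a, b, c, d, linked_iff_of_signs hg hg' (.inl ⟨h6, h5, h3, h4⟩)⟩
  have hex : ∃ a b c d, Linked K L a b c d := by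
    obtain ⟨x, hx, y, hy, hxy⟩ := hgt
    rcases lt_trichotomy y 0 with hy0 | rfl | hy0
    · obtain ⟨w, hw, hw0⟩ := hpos
      obtain ⟨a, b, c, d, h⟩ := start hK.isCompact.neg hL.isCompact.neg hKL' (by simpa using h0)
        ⟨-w, by simpa using hw, by linarith⟩ (-x) (by simpa using hx) (-y) (by simpa using hy)
        (by linarith) (by linarith)
      exact ⟨_, _, _, _, h.neg⟩
    · simp at hxy; linarith
    · exact start hK.isCompact hL.isCompact hKL h0 hneg x hx y hy hy0 hxy
  obtain ⟨a, b, c, d, h, hmin⟩ := exists_minimal_linked hK.isCompact hL.isCompact hKL hex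
  have hnegg : ∀ {S : Set ℝ} {a b : ℝ}, IsBoundedGap S a b → IsBoundedGap (-S) (-b) (-a) :=
    fun {S a b} h => IsBoundedGap.neg (by rwa [neg_neg])
  have : ∃ a' b' c' d', Linked K L a' b' c' d' ∧
      (b' - a') + (d' - c') < (b - a) + (d - c) := by
    rcases h.cases with ⟨h1, h2, h3, h4⟩ | ⟨h1, h2, h3, h4⟩ | ⟨h1, h2, h3, h4⟩ | ⟨h1, h2, h3, h4⟩
    · exact exists_shorter_of_high hK hL hM hN hMN hc h0 hKL h.1 h.2.1 h2 h3 h4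
    · exact exists_shorter_of_low hK hL hM hN hMN hKL h.1 h.2.1 h1 h2 h3 h4
    · obtain ⟨a', b', c', d', h', hlt⟩ := exists_shorter_of_high hK.neg hL.neg hM hN hMN hc
        (by simpa using h0) hKL' (hnegg h.1) (hnegg h.2.1)
        (by linarith) (by linarith) (by linarith)
      exact ⟨_, _, _, _, h'.neg, by linarith⟩
    · obtain ⟨a', b', c', d', h', hlt⟩ := exists_shorter_of_low hK.neg hL.neg hM hN hMN
        hKL' (hnegg h.1) (hnegg h.2.1)
        (by linarith) (by linarith) (by linarith) (by linarith)
      exact ⟨_, _, _, _, h'.neg, by linarith⟩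
  obtain ⟨a', b', c', d', h', hlt⟩ := this
  exact absurd (hmin _ _ _ _ h') (not_le.2 hlt)

/-- The gap lemma for products of sets on the right of `0`. -/
theorem exists_mul_eq_one_of_nonneg (hK : ThickHull K p q M) (hL : ThickHull L u v M)
    (hM : 2 ≤ M) (hp : 0 ≤ p) (hu : 0 ≤ u) (hKM : p ≤ M * (q - p)) (hLM : u ≤ M * (v - u))
    (h1 : p * u ≤ 1) (h2 : 1 ≤ q * v) : ∃ x ∈ K, ∃ y ∈ L, x * y = 1 := by
  by_contra! hKL
  have hM0 : 0 < M := by linarith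
  have hMM : 1 < M * M := by nlinarith
  have hKpos : ∀ x ∈ K, 0 ≤ x := fun x hx => hp.trans (hK.isLeast.2 hx)
  have hLpos : ∀ x ∈ L, 0 ≤ x := fun x hx => hu.trans (hL.isLeast.2 hx)
  have hpK := hK.isLeast.1
  have hqK := hK.isGreatest.1
  have huL := hL.isLeast.1
  have hvL := hL.isGreatest.1
  replace h1 := lt_of_le_of_ne h1 (hKL p hpK u huL)
  replace h2 := lt_of_le_of_ne h2 (hKL q hqK v hvL).symm
  have hq : 0 < q := lt_of_le_of_ne (hKpos q hqK) (by rintro rfl; simp at h2; linarith)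
  have hv : 0 < v := lt_of_le_of_ne (hLpos v hvL) (by rintro rfl; simp at h2; linarith)
  have huv : u ≤ v := hL.isGreatest.2 huL
  have hpq : p ≤ q := hK.isGreatest.2 hpK
  have hex : ∃ a b c d, Linked K L a b c d := by
    rcases lt_or_gt_of_ne (hKL p hpK v hvL) with h3 | h3
    · have hz : v⁻¹ ∉ K := inv_notMem hKL hvL hv.ne'
      obtain ⟨a, b, hg, hpa, ha, hb, -⟩ := exists_gap hK.isCompact hpK hqK hz
        (by rw [← one_div, le_div_iff₀ hv]; exact h3.le)
        (by rw [← one_div, div_le_iff₀ hv]; exact h2.le)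
      rw [← one_div, lt_div_iff₀ hv] at ha
      rw [← one_div, div_lt_iff₀ hv] at hb
      have hb0 : 0 < b := by by_contra!; nlinarith
      -- Here `b * u ≤ a * v`: the extra `(b - a) * u` is at most `M * (b - a) * (v - u) ≤ a * (v -
      -- u)`.
      have hbu : b * u < 1 := by
        refine lt_of_le_of_lt ?_ ha
        have k1 := hK.left _ _ hg
        have k2 := hg.2.2.1
        have k3 := sub_pos.2 k2
        nlinarith [mul_le_mul_of_nonneg_right hLM k3.le]
      have hz' : b⁻¹ ∉ L := fun h => hKL b hg.2.1 _ h (mul_inv_cancel₀ hb0.ne')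
      obtain ⟨c, d, hg', -, hc, hd, hdv⟩ := exists_gap hL.isCompact huL hvL hz'
        (by rw [← one_div, le_div_iff₀ hb0]; linarith)
        (by rw [← one_div, div_le_iff₀ hb0]; linarith)
      rw [← one_div, lt_div_iff₀ hb0] at hc
      rw [← one_div, div_lt_iff₀ hb0] at hd
      have ha0 := hKpos a hg.1
      have e1 : a * d < 1 := by nlinarith
      have e2 : a * c < 1 := by nlinarith [hg'.2.2.1]
      exact ⟨a, b, c, d, linked_iff_of_signs hg hg' (.inl ⟨e2, e1, by linarith, by linarith⟩)⟩
    · have hp0 : 0 < p := lt_of_le_of_ne hp (by rintro rfl; simp at h3; linarith)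
      have hz' : p⁻¹ ∉ L := fun h => hKL p hpK _ h (mul_inv_cancel₀ hp0.ne')
      obtain ⟨c, d, hg', huc, hc, hd, -⟩ := exists_gap hL.isCompact huL hvL hz'
        (by rw [← one_div, le_div_iff₀ hp0]; linarith)
        (by rw [← one_div, div_le_iff₀ hp0]; linarith)
      rw [← one_div, lt_div_iff₀ hp0] at hc
      rw [← one_div, div_lt_iff₀ hp0] at hd
      have hqc : 1 < q * c := by
        refine lt_of_lt_of_le hd ?_
        have k1 := hL.left _ _ hg'
        have k2 := hg'.2.2.1
        have k3 := sub_pos.2 k2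
        nlinarith [mul_le_mul_of_nonneg_right hKM k3.le]
      have hc0 : 0 < c := by by_contra!; nlinarith
      have hz : c⁻¹ ∉ K := inv_notMem hKL hg'.1 hc0.ne'
      obtain ⟨a, b, hg, hpa, ha, hb, -⟩ := exists_gap hK.isCompact hpK hqK hz
        (by rw [← one_div, le_div_iff₀ hc0]; linarith)
        (by rw [← one_div, div_le_iff₀ hc0]; linarith)
      rw [← one_div, lt_div_iff₀ hc0] at ha
      rw [← one_div, div_lt_iff₀ hc0] at hb
      have e1 : 1 < a * d := by nlinarith [hg'.2.2.1]
      have e2 : 1 < b * d := by nlinarith [hg'.2.2.1]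
      exact ⟨a, b, c, d, linked_iff_of_signs hg hg' (.inr (.inl ⟨ha, e1, hb, e2⟩))⟩
  obtain ⟨a, b, c, d, h, hmin⟩ := exists_minimal_linked hK.isCompact hL.isCompact hKL hex
  have hab := h.1.2.2.1
  have hcd := h.2.1.2.2.1
  have ha0 := hKpos a h.1.1
  have hc0 := hLpos c h.2.1.1
  have hb0 : 0 < b := ha0.trans_lt hab
  have hd0 : 0 < d := hc0.trans_lt hcd
  have hac : a * c ≤ b * d := mul_le_mul hab.le hcd.le hc0 hb0.le
  -- Since `a * c ≤ b * d`, the reflected patterns cannot occur. In the high pattern, nonnegativity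
  -- of the sets gives `(M + 1) * x ≤ 1` and `(M + 1) * y ≤ 1`; with the ratio inequalities this
  -- forces `M ^ 2 - 1 < M`, false for `M ≥ 2`.
  rcases h.cases with ⟨h1, h2, h3, h4⟩ | ⟨h1, h2, h3, h4⟩ | ⟨h1, h2, h3, h4⟩ | ⟨h1, h2, h3, h4⟩
  · have h5 := ratio_lt hb0 hd0 h4 (lt_one_of_minimal_high hK hM0 hKL h.1 h.2.1 h2 h3 h4
      fun a' b' h' => by linarith [hmin _ _ _ _ h'])
    have h6 := ratio_lt hd0 hb0 (by linarith) (lt_one_of_minimal_high hL hM0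
      (fun x hx y hy => by rw [mul_comm]; exact hKL y hy x hx) h.2.1 h.1
      (by linarith) (by linarith) (by linarith : 1 < d * b) fun c' d' h' => by
      linarith [hmin _ _ _ _ h'.swap])
    have hx : (M + 1) * ((b - a) / b) ≤ 1 := by
      have := hK.left _ _ h.1
      rw [← mul_div_assoc, div_le_one hb0]; linarith
    have hy : (M + 1) * ((d - c) / d) ≤ 1 := by
      have := hL.left _ _ h.2.1
      rw [← mul_div_assoc, div_le_one hd0]; linarith
    have hx0 := div_pos (sub_pos.2 hab) hb0
    have hy0 := div_pos (sub_pos.2 hcd) hd0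
    generalize (b - a) / b = x at *
    generalize (d - c) / d = y at *
    have m1 := mul_le_mul_of_nonneg_right hx hy0.le
    have m2 := mul_le_mul_of_nonneg_right hy hx0.le
    have m3 := mul_pos hx0 hy0
    nlinarith
  · obtain ⟨a', b', c', d', h', hlt⟩ :=
      exists_shorter_of_low hK hL hM0 hM0 hMM hKL h.1 h.2.1 h1 h2 h3 h4
    exact absurd (hmin _ _ _ _ h') (not_le.2 hlt)
  · linarith
  · linarith

end

/-! ### From the gap lemmas to intervals; part (a) -/

theorem thicknessRatios_nonneg {K : Set ℝ} (hK : IsCompact K) :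
    ∀ r ∈ thicknessRatios K, 0 ≤ r := by
  rintro r ((⟨a, b, a', b', h, h', hb, rfl⟩ | ⟨a, b, h, rfl⟩) | ⟨a, b, h, rfl⟩)
  · exact le_max_of_le_left (div_nonneg (sub_nonneg.2 hb.le) (sub_nonneg.2 h.2.2.1.le))
  · exact div_nonneg (sub_nonneg.2 (csInf_le hK.bddBelow h.1)) (sub_nonneg.2 h.2.2.1.le)
  · exact div_nonneg (sub_nonneg.2 (le_csSup hK.bddAbove h.2.1)) (sub_nonneg.2 h.2.2.1.le)

theorem thickness_le {K : Set ℝ} (hK : IsCompact K) {r : ℝ} (hr : r ∈ thicknessRatios K) :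
    thickness K ≤ r :=
  csInf_le ⟨0, fun _ h => thicknessRatios_nonneg hK _ h⟩ hr

theorem IsCantorSet.gap_ne {K : Set ℝ} (hK : IsCantorSet K) {a b b' : ℝ}
    (h : IsBoundedGap K a b) (h' : IsBoundedGap K b b') : False := by
  obtain ⟨y, ⟨hy, hyK⟩, hne⟩ := preperfect_iff_nhds.1 hK.perfect.acc b h.2.1 (Ioo a b')
    (Ioo_mem_nhds h.2.2.1 h'.2.2.1)
  rcases h.le_or_le hyK with h1 | h1
  · exact absurd hy.1 (not_lt.2 h1)
  rcases h'.le_or_le hyK with h2 | h2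
  · exact hne (le_antisymm h2 h1)
  · exact absurd hy.2 (not_lt.2 h2)

theorem IsCantorSet.thickHull {K : Set ℝ} (hK : IsCantorSet K) :
    ThickHull K (sInf K) (sSup K) (thickness K) where
  isCompact := hK.isCompact
  isLeast := hK.isCompact.isLeast_sInf hK.nonempty
  isGreatest := hK.isCompact.isGreatest_sSup hK.nonempty
  left a b h := (le_div_iff₀ (sub_pos.2 h.2.2.1)).1
    (thickness_le hK.isCompact (.inl (.inr ⟨a, b, h, rfl⟩)))
  right a b h := (le_div_iff₀ (sub_pos.2 h.2.2.1)).1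
    (thickness_le hK.isCompact (.inr ⟨a, b, h, rfl⟩))
  pair a b a' b' h h' hb := by
    rcases hb.eq_or_lt with rfl | hb
    · exact (hK.gap_ne h h').elim
    rw [← le_div_iff₀ (sub_pos.2 h.2.2.1), ← le_div_iff₀ (sub_pos.2 h'.2.2.1), ← le_max_iff]
    exact thickness_le hK.isCompact (.inl (.inl ⟨a, b, a', b', h, h', hb, rfl⟩))

section
variable {K L : Set ℝ} {p q M u v N : ℝ}

theorem mem_mul_of_pos (hK : ThickHull K p q M) (hL : ThickHull L u v N)
    (hM : 0 < M) (hN : 0 < N) (hMN : 1 < M * N)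
    (hc : 2 * (M + 1) * (N + 1) ≤ (M * N - 1) ^ 2) (h0 : (0 : ℝ) ∈ K)
    (hneg : ∃ y ∈ L, y < 0) (hpos : ∃ y ∈ L, 0 < y) {t : ℝ} (ht : 0 < t)
    (hgt : ∃ x ∈ K, ∃ y ∈ L, t ≤ x * y) : t ∈ K * L := by
  obtain ⟨x, hx, y, hy, hxy⟩ := hgt
  rcases hxy.eq_or_lt with rfl | hxy
  · exact mul_mem_mul hx hy
  have hti := inv_pos.2 ht
  have key : ∀ w ∈ L, t⁻¹ * w + 0 ∈ affineCopy t⁻¹ 0 L := fun w hw => ⟨w, hw, rfl⟩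
  obtain ⟨w, hw, hwn⟩ := hneg
  obtain ⟨w', hw', hwp⟩ := hpos
  obtain ⟨x', hx', _, ⟨y', hy', rfl⟩, h⟩ :=
    exists_mul_eq_one hK (hL.affineCopy hti (r := 0)) hM hN hMN hc h0
    ⟨_, key w hw, by nlinarith⟩ ⟨_, key w' hw', by positivity⟩
    ⟨x, hx, _, key y hy, by
      have : x * (t⁻¹ * y + 0) = x * y / t := by field_simp; ring
      rw [this, one_lt_div ht]; exact hxy⟩
  refine ⟨x', hx', y', hy', ?_⟩
  simp only [add_zero] at h
  field_simp at h
  exact h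

theorem mul_eq_Icc_of_two_sided (hK : ThickHull K p q M) (hL : ThickHull L u v N)
    (hM : 0 < M) (hN : 0 < N) (hMN : 1 < M * N)
    (hc : 2 * (M + 1) * (N + 1) ≤ (M * N - 1) ^ 2) (h0 : (0 : ℝ) ∈ K) (hKpos : ∃ x ∈ K, 0 < x)
    (hneg : ∃ y ∈ L, y < 0) (hpos : ∃ y ∈ L, 0 < y) :
    ∃ a b : ℝ, a < b ∧ K * L = Icc a b := by
  have hcomp : IsCompact (K * L) := hK.isCompact.mul hL.isCompact
  have hne : (K * L).Nonempty := ⟨_, mul_mem_mul h0 hL.isLeast.1⟩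
  obtain ⟨x, hx, hx0⟩ := hKpos
  obtain ⟨w, hw, hw0⟩ := hneg
  obtain ⟨w', hw', hw'0⟩ := hpos
  obtain ⟨⟨x₁, hx₁, y₁, hy₁, h1⟩, hl⟩ := hcomp.isLeast_sInf hne
  obtain ⟨⟨x₂, hx₂, y₂, hy₂, h2⟩, hg⟩ := hcomp.isGreatest_sSup hne
  simp only at h1 h2
  refine ⟨sInf (K * L), sSup (K * L), ?_, Subset.antisymm (fun z hz => ⟨hl hz, hg hz⟩) ?_⟩
  · calc _ ≤ x * w := hl (mul_mem_mul hx hw)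
      _ < 0 := mul_neg_of_pos_of_neg hx0 hw0
      _ < x * w' := mul_pos hx0 hw'0
      _ ≤ _ := hg (mul_mem_mul hx hw')
  · rintro t ⟨ht1, ht2⟩
    rcases lt_trichotomy t 0 with ht | rfl | ht
    · obtain ⟨x', hx', y', hy', h⟩ := mem_mul_of_pos hK hL.neg hM hN hMN hc h0
        ⟨-w', by simpa using hw', by linarith⟩ ⟨-w, by simpa using hw, by linarith⟩
        (neg_pos.2 ht) ⟨x₁, hx₁, -y₁, by simpa using hy₁, by linarith⟩
      exact ⟨x', hx', -y', hy', by simp only at h ⊢; linarith⟩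
    · exact ⟨0, h0, w, hw, zero_mul _⟩
    · exact mem_mul_of_pos hK hL hM hN hMN hc h0 ⟨w, hw, hw0⟩ ⟨w', hw', hw'0⟩ ht
        ⟨x₂, hx₂, y₂, hy₂, by linarith⟩

theorem mul_eq_Icc_of_nonneg (hK : ThickHull K p q M) (hL : ThickHull L u v M)
    (hM : 2 ≤ M) (hp : 0 ≤ p) (hu : 0 ≤ u) (hKM : p ≤ M * (q - p)) (hLM : u ≤ M * (v - u)) :
    K * L = Icc (p * u) (q * v) := by
  apply Subset.antisymm
  · rintro _ ⟨x, hx, y, hy, rfl⟩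
    have h1 := hK.isLeast.2 hx
    have h2 := hL.isLeast.2 hy
    have h3 := hK.isGreatest.2 hx
    have h4 := hL.isGreatest.2 hy
    exact ⟨mul_le_mul h1 h2 hu (by linarith), mul_le_mul h3 h4 (by linarith) (by linarith)⟩
  · rintro t ⟨ht1, ht2⟩
    rcases (mul_nonneg hp hu |>.trans ht1).eq_or_lt with rfl | ht
    · have := le_antisymm ht1 (mul_nonneg hp hu)
      rw [← this]
      exact mul_mem_mul hK.isLeast.1 hL.isLeast.1
    · have hti := inv_pos.2 ht
      obtain ⟨x', hx', _, ⟨y', hy', rfl⟩, h⟩ :=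
        exists_mul_eq_one_of_nonneg hK (hL.affineCopy hti (r := 0)) hM hp (by positivity) hKM
        (by have := mul_le_mul_of_nonneg_left hLM hti.le; linarith)
        (by
          have : p * (t⁻¹ * u + 0) = p * u / t := by field_simp; ring
          rw [this, div_le_one ht]; exact ht1)
        (by
          have : q * (t⁻¹ * v + 0) = q * v / t := by field_simp; ring
          rw [this, one_le_div ht]; exact ht2)
      refine ⟨x', hx', y', hy', ?_⟩
      simp only [add_zero] at h
      field_simp at h
      exact h

end

theorem zero_mem_of_sInf_plusPart {K : Set ℝ} (hK : IsCantorSet K)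
    (hne : (plusPart K).Nonempty) (h : sInf (plusPart K) = 0) : (0 : ℝ) ∈ K := by
  have h1 : sInf (plusPart K) ∈ closure (plusPart K) :=
    csInf_mem_closure hne (hK.isCompact.bddBelow.mono inter_subset_left)
  rw [h] at h1
  exact closure_minimal inter_subset_left hK.perfect.closed h1

/-- All four types share what the argument needs: `K` accumulates at `0` from the right, and `L` has
points of both signs. -/
theorem PairType.Holds.exists_Icc {t : PairType} {K L : Set ℝ} (h : t.Holds K L)
    (hc : 2 * (thickness K + 1) * (thickness L + 1) ≤ (thickness K * thickness L - 1) ^ 2) :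
    ∃ a b : ℝ, a < b ∧ K * L = Icc a b := by
  obtain ⟨hK, hKp, hK0, hL, hLp, hLn⟩ : IsCantorSet K ∧ (plusPart K).Nonempty ∧
      sInf (plusPart K) = 0 ∧ IsCantorSet L ∧ (plusPart L).Nonempty ∧ (minusPart L).Nonempty := by
    cases t
    all_goals
      obtain ⟨hK, hL⟩ := h
      exact ⟨hK.1, hK.2, hK.4, hL.1, hL.2, hL.3⟩
  have h0 := zero_mem_of_sInf_plusPart hK hKp hK0
  have hM : 0 ≤ thickness K := Real.sInf_nonneg (thicknessRatios_nonneg hK.isCompact)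
  have hN : 0 ≤ thickness L := Real.sInf_nonneg (thicknessRatios_nonneg hL.isCompact)
  -- If the product were at most `1`, the right side of `hc` would be at most `1` and the left side
  -- at least `2`.
  have hMN : 1 < thickness K * thickness L := by
    by_contra! h1
    have h2 := mul_nonneg hM hN
    nlinarith
  have hM' : 0 < thickness K := lt_of_le_of_ne hM fun h => by rw [← h] at hMN; linarith
  have hN' : 0 < thickness L := lt_of_le_of_ne hN fun h => by rw [← h] at hMN; linarith
  obtain ⟨x, hx, hx0⟩ := hKp
  obtain ⟨y, hy, hy0⟩ := hLp
  obtain ⟨z, hz, hz0⟩ := hLn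
  exact mul_eq_Icc_of_two_sided hK.thickHull hL.thickHull hM' hN' hMN hc h0 ⟨x, hx, hx0⟩
    ⟨-z, hz, hz0⟩ ⟨y, hy, hy0⟩

/-! ### Gluing blocks -/

open Filter Topology

section
variable {A B K : Set ℝ} {a₀ a₁ b₀ b₁ a b p q M N : ℝ}

/-- Touching blocks, `a₁ = b₀`, are allowed: they occur at `0` in the `0`-Cantor sets. -/
theorem gap_union (hA : IsGreatest A a₁) (hB : IsLeast B b₀) (h : a₁ ≤ b₀)
    (hg : IsBoundedGap (A ∪ B) a b) :
    IsBoundedGap A a b ∨ IsBoundedGap B a b ∨ (a = a₁ ∧ b = b₀) := by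
  have l1 := hg.le_or_le (.inl hA.1)
  have l2 := hg.le_or_le (.inr hB.1)
  obtain ⟨ha, hb, hab, hg'⟩ := hg
  rcases ha with ha | ha <;> rcases hb with hb | hb
  · exact .inl ⟨ha, hb, hab, fun x hx hxA => hg' x hx (.inl hxA)⟩
  · have h1 := hA.2 ha
    have h2 := hB.2 hb
    rcases l1 with l1 | l1
    · rcases l2 with l2 | l2
      · obtain rfl : a = b₀ := by linarith
        exact .inr (.inl ⟨hB.1, hb, hab, fun x hx hxB => hg' x hx (.inr hxB)⟩)
      · exact .inr (.inr ⟨le_antisymm h1 l1, le_antisymm l2 h2⟩)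
    · obtain rfl : b = a₁ := by linarith
      exact .inl ⟨ha, hA.1, hab, fun x hx hxA => hg' x hx (.inl hxA)⟩
  · have h1 := hB.2 ha
    have h2 := hA.2 hb
    linarith
  · exact .inr (.inl ⟨ha, hb, hab, fun x hx hxB => hg' x hx (.inr hxB)⟩)

/-- Two gaps in different blocks are separated by at least the distance from either gap to the inner
end of its block, so the one-sided bounds of the blocks settle all mixed pairs. -/
theorem ThickHull.union (hA : ThickHull A a₀ a₁ M) (hB : ThickHull B b₀ b₁ M) (h : a₁ ≤ b₀)
    (hl : M * (b₀ - a₁) ≤ a₁ - a₀) (hr : M * (b₀ - a₁) ≤ b₁ - b₀) :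
    ThickHull (A ∪ B) a₀ b₁ M := by
  have h01 : a₀ ≤ a₁ := hA.isLeast.2 hA.isGreatest.1
  have hb01 : b₀ ≤ b₁ := hB.isLeast.2 hB.isGreatest.1
  have cases := fun a b => gap_union (a := a) (b := b) hA.isGreatest hB.isLeast h
  refine ⟨hA.isCompact.union hB.isCompact, ⟨.inl hA.isLeast.1, ?_⟩,
    ⟨.inr hB.isGreatest.1, ?_⟩, ?_, ?_, ?_⟩
  · rintro x (hx | hx)
    · exact hA.isLeast.2 hx
    · linarith [hB.isLeast.2 hx]
  · rintro x (hx | hx)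
    · linarith [hA.isGreatest.2 hx]
    · exact hB.isGreatest.2 hx
  · intro a b hg
    rcases cases a b hg with h1 | h1 | ⟨rfl, rfl⟩
    · exact hA.left _ _ h1
    · linarith [hB.left _ _ h1]
    · exact hl
  · intro a b hg
    rcases cases a b hg with h1 | h1 | ⟨rfl, rfl⟩
    · linarith [hA.right _ _ h1]
    · exact hB.right _ _ h1
    · exact hr
  · intro a b a' b' hg hg' hb
    have hab := hg.2.2.1
    have hab' := hg'.2.2.1
    rcases cases a b hg with h1 | h1 | ⟨rfl, rfl⟩ <;>
      rcases cases a' b' hg' with h2 | h2 | ⟨rfl, rfl⟩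
    · exact hA.pair _ _ _ _ h1 h2 hb
    · left; linarith [hA.right _ _ h1, hB.isLeast.2 h2.1]
    · left; linarith [hA.right _ _ h1]
    · linarith [hB.isLeast.2 h1.1, hA.isGreatest.2 h2.2.1]
    · exact hB.pair _ _ _ _ h1 h2 hb
    · linarith [hB.isLeast.2 h1.1]
    · linarith [hA.isGreatest.2 h2.2.1]
    · right; linarith [hB.left _ _ h2]
    · linarith

theorem ThickHull.mono (h : ThickHull K p q M) (hN : N ≤ M) : ThickHull K p q N where
  isCompact := h.isCompact
  isLeast := h.isLeast
  isGreatest := h.isGreatest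
  left _ _ hg := (mul_le_mul_of_nonneg_right hN (sub_pos.2 hg.2.2.1).le).trans (h.left _ _ hg)
  right _ _ hg := (mul_le_mul_of_nonneg_right hN (sub_pos.2 hg.2.2.1).le).trans (h.right _ _ hg)
  pair _ _ _ _ hg hg' hb := (h.pair _ _ _ _ hg hg' hb).imp
    (mul_le_mul_of_nonneg_right hN (sub_pos.2 hg.2.2.1).le).trans
    (mul_le_mul_of_nonneg_right hN (sub_pos.2 hg'.2.2.1).le).trans

/-- The hull bounds make `M` a lower bound of all ratios; the given gap attains it against the
unbounded gap on the right. -/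
theorem ThickHull.thickness_eq (h : ThickHull K p q M) (hg : IsBoundedGap K a b)
    (he : q - b = M * (b - a)) : thickness K = M := by
  have hp : sInf K = p := h.isLeast.csInf_eq
  have hq : sSup K = q := h.isGreatest.csSup_eq
  have hpos := sub_pos.2 hg.2.2.1
  have hmem : M ∈ thicknessRatios K := by
    refine .inr ⟨a, b, hg, ?_⟩
    rw [hq, he, mul_div_cancel_right₀ _ hpos.ne']
  refine le_antisymm (thickness_le h.isCompact hmem) (le_csInf ⟨_, hmem⟩ ?_)
  rintro r ((⟨a, b, a', b', h1, h2, hb, rfl⟩ | ⟨a, b, h1, rfl⟩) | ⟨a, b, h1, rfl⟩)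
  · rw [le_max_iff, le_div_iff₀ (sub_pos.2 h1.2.2.1), le_div_iff₀ (sub_pos.2 h2.2.2.1)]
    exact h.pair _ _ _ _ h1 h2 hb.le
  · rw [le_div_iff₀ (sub_pos.2 h1.2.2.1), hp]
    exact h.left _ _ h1
  · rw [le_div_iff₀ (sub_pos.2 h1.2.2.1), hq]
    exact h.right _ _ h1

theorem IsCantorSet.union (hA : IsCantorSet A) (hB : IsCantorSet B) : IsCantorSet (A ∪ B) where
  nonempty := hA.nonempty.inl
  isCompact := hA.isCompact.union hB.isCompact
  perfect := by
    refine ⟨hA.perfect.closed.union hB.perfect.closed, preperfect_iff_nhds.2 ?_⟩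
    rintro x (hx | hx) U hU
    · obtain ⟨y, hy, hne⟩ := preperfect_iff_nhds.1 hA.perfect.acc x hx U hU
      exact ⟨y, ⟨hy.1, .inl hy.2⟩, hne⟩
    · obtain ⟨y, hy, hne⟩ := preperfect_iff_nhds.1 hB.perfect.acc x hx U hU
      exact ⟨y, ⟨hy.1, .inr hy.2⟩, hne⟩
  nowhereDense := by
    have h1 := hA.nowhereDense
    have h2 := hB.nowhereDense
    unfold IsNowhereDense at *
    rw [closure_union, interior_union_isClosed_of_interior_empty isClosed_closure h2, h1]

theorem IsCantorSet.affineCopy (hK : IsCantorSet K) {s r : ℝ} (hs : 0 < s) :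
    IsCantorSet (affineCopy s r K) := by
  have hf : Continuous fun x : ℝ => s * x + r := by fun_prop
  have hc : IsCompact (CantorProduct.affineCopy s r K) := hK.isCompact.image hf
  refine ⟨hK.nonempty.image _, hc, ⟨hc.isClosed, preperfect_iff_nhds.2 ?_⟩, ?_⟩
  · rintro _ ⟨x, hx, rfl⟩ U hU
    obtain ⟨y, hy, hne⟩ := preperfect_iff_nhds.1 hK.perfect.acc x hx _ (hf.continuousAt hU)
    refine ⟨s * y + r, ⟨hy.1, y, hy.2, rfl⟩, fun h => hne ?_⟩
    simp only [add_left_inj] at h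
    exact mul_left_cancel₀ hs.ne' h
  · have h := hK.nowhereDense
    unfold IsNowhereDense at *
    rw [hc.isClosed.closure_eq]
    rw [hK.isCompact.isClosed.closure_eq] at h
    rw [eq_empty_iff_forall_notMem]
    intro y hy
    obtain ⟨x, hx, rfl⟩ := interior_subset hy
    have : x ∈ interior K := by
      refine mem_interior.2 ⟨_, ?_, isOpen_interior.preimage hf, hy⟩
      intro z hz
      obtain ⟨w, hw, hwz⟩ := interior_subset hz
      simp only [add_left_inj] at hwz
      rwa [← mul_left_cancel₀ hs.ne' hwz]
    rw [h] at this
    exact this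

end

/-! ### Self-similar Cantor sets as blocks of prescribed hull and thickness -/

/-- The stages of the construction of the self-similar Cantor set with two pieces of ratio `l`. -/
def preCantor (l : ℝ) : ℕ → Set ℝ
  | 0 => Icc 0 1
  | n + 1 => affineCopy l 0 (preCantor l n) ∪ affineCopy l (1 - l) (preCantor l n)

/-- The Cantor set in `[0, 1]` with `C = l C ∪ (1 - l + l C)`. -/
def centralCantor (l : ℝ) : Set ℝ := ⋂ n, preCantor l n

section
variable {l T : ℝ}

theorem zero_mem_preCantor (n : ℕ) : (0 : ℝ) ∈ preCantor l n := by
  induction n with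
  | zero => simp [preCantor]
  | succ n ih => exact .inl ⟨0, ih, by simp⟩

theorem one_mem_preCantor (n : ℕ) : (1 : ℝ) ∈ preCantor l n := by
  induction n with
  | zero => simp [preCantor]
  | succ n ih => exact .inr ⟨1, ih, by simp⟩

theorem isCompact_preCantor (n : ℕ) : IsCompact (preCantor l n) := by
  induction n with
  | zero => exact isCompact_Icc
  | succ n ih => exact (ih.image (by fun_prop)).union (ih.image (by fun_prop))

theorem preCantor_subset (hl : 0 < l) (hl2 : l < 1 / 2) (n : ℕ) :
    preCantor l n ⊆ Icc 0 1 := by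
  induction n with
  | zero => exact subset_rfl
  | succ n ih =>
    rintro _ (⟨x, hx, rfl⟩ | ⟨x, hx, rfl⟩) <;>
    · have := ih hx
      constructor <;> simp only <;> nlinarith [this.1, this.2]

theorem centralCantor_subset : centralCantor l ⊆ Icc 0 1 := iInter_subset _ 0

theorem isCompact_centralCantor : IsCompact (centralCantor l) :=
  isCompact_Icc.of_isClosed_subset
    (isClosed_iInter fun n => (isCompact_preCantor n).isClosed) centralCantor_subset

/-- As `l < 1 / 2`, the point `1 / 2` separates the two pieces, so the piece containing `x` is the
same at every stage and the intersection commutes with the union. -/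
theorem centralCantor_eq (hl : 0 < l) (hl2 : l < 1 / 2) :
    centralCantor l = affineCopy l 0 (centralCantor l) ∪ affineCopy l (1 - l) (centralCantor l) := by
  ext x
  simp only [mem_union, mem_affineCopy hl]
  constructor
  · intro hx
    have hx' := mem_iInter.1 hx
    have h : ∀ n, (x - 0) / l ∈ preCantor l n ∨ (x - (1 - l)) / l ∈ preCantor l n := fun n => by
      simpa only [preCantor, mem_union, mem_affineCopy hl] using hx' (n + 1)
    rcases le_total x (1 / 2) with h1 | h1
    · refine .inl (mem_iInter.2 fun n => (h n).resolve_right fun h2 => ?_)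
      have h3 := (preCantor_subset hl hl2 n h2).1
      rw [le_div_iff₀ hl] at h3
      linarith
    · refine .inr (mem_iInter.2 fun n => (h n).resolve_left fun h2 => ?_)
      have h3 := (preCantor_subset hl hl2 n h2).2
      rw [div_le_iff₀ hl] at h3
      linarith
  · intro hx
    have h : ∀ n, x ∈ preCantor l (n + 1) := fun n => by
      simp only [preCantor, mem_union, mem_affineCopy hl]
      exact hx.imp (fun h => mem_iInter.1 h n) (fun h => mem_iInter.1 h n)
    refine mem_iInter.2 fun n => ?_
    cases n with
    | zero => exact preCantor_subset hl hl2 1 (h 0)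
    | succ n => exact h n

theorem isLeast_centralCantor : IsLeast (centralCantor l) 0 :=
  ⟨mem_iInter.2 zero_mem_preCantor, fun _ h => (centralCantor_subset h).1⟩

theorem isGreatest_centralCantor : IsGreatest (centralCantor l) 1 :=
  ⟨mem_iInter.2 one_mem_preCantor, fun _ h => (centralCantor_subset h).2⟩

theorem gap_centralCantor (hl : 0 < l) (hl2 : l < 1 / 2) {a b : ℝ}
    (h : IsBoundedGap (centralCantor l) a b) :
    (∃ a' b', IsBoundedGap (centralCantor l) a' b' ∧ a = l * a' ∧ b = l * b') ∨
    (∃ a' b', IsBoundedGap (centralCantor l) a' b' ∧ a = l * a' + (1 - l) ∧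
      b = l * b' + (1 - l)) ∨ (a = l ∧ b = 1 - l) := by
  rw [centralCantor_eq hl hl2] at h
  have hA : IsGreatest (affineCopy l 0 (centralCantor l)) l := by
    refine ⟨⟨1, isGreatest_centralCantor.1, by simp⟩, ?_⟩
    rintro _ ⟨x, hx, rfl⟩
    have := (centralCantor_subset hx).2
    simp only; nlinarith
  have hB : IsLeast (affineCopy l (1 - l) (centralCantor l)) (1 - l) := by
    refine ⟨⟨0, isLeast_centralCantor.1, by simp⟩, ?_⟩
    rintro _ ⟨x, hx, rfl⟩
    have := (centralCantor_subset hx).1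
    simp only; nlinarith
  rcases gap_union hA hB (by linarith) h with h1 | h1 | h1
  · exact .inl ⟨_, _, h1.of_affineCopy hl, by field_simp; ring, by field_simp; ring⟩
  · exact .inr (.inl ⟨_, _, h1.of_affineCopy hl, by field_simp; ring, by field_simp; ring⟩)
  · exact .inr (.inr h1)

/-- A gap other than the middle one is a copy, scaled by `l`, of a longer gap. As no gap is longer
than `1`, induction on `n` with `l ^ n < b - a` terminates. The middle gap gives equality, by `hlT`.
-/
theorem gap_centralCantor_hull (hl : 0 < l) (hl2 : l < 1 / 2)
    (hlT : T * (1 - 2 * l) = l) {a b : ℝ} (h : IsBoundedGap (centralCantor l) a b) :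
    T * (b - a) ≤ a ∧ T * (b - a) ≤ 1 - b := by
  obtain ⟨n, hn⟩ := exists_pow_lt_of_lt_one (sub_pos.2 h.2.2.1) (by linarith : l < 1)
  induction n generalizing a b with
  | zero =>
    have h1 := (centralCantor_subset h.1).1
    have h2 := (centralCantor_subset h.2.1).2
    simp only [pow_zero] at hn
    linarith
  | succ n ih =>
    rcases gap_centralCantor hl hl2 h with ⟨a', b', h', rfl, rfl⟩ | ⟨a', b', h', rfl, rfl⟩ |
      ⟨rfl, rfl⟩
    · obtain ⟨h1, h2⟩ := ih h' (by
        rw [pow_succ] at hn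
        exact lt_of_mul_lt_mul_right (by linarith : l ^ n * l < (b' - a') * l) hl.le)
      constructor <;> nlinarith
    · obtain ⟨h1, h2⟩ := ih h' (by
        rw [pow_succ] at hn
        exact lt_of_mul_lt_mul_right (by linarith : l ^ n * l < (b' - a') * l) hl.le)
      constructor <;> nlinarith
    · constructor <;> linarith

theorem gap_centralCantor_pair (hl : 0 < l) (hl2 : l < 1 / 2)
    (hlT : T * (1 - 2 * l) = l) {a b a' b' : ℝ} (h : IsBoundedGap (centralCantor l) a b)
    (h' : IsBoundedGap (centralCantor l) a' b') (hb : b ≤ a') :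
    T * (b - a) ≤ a' - b ∨ T * (b' - a') ≤ a' - b := by
  obtain ⟨n, hn⟩ := exists_pow_lt_of_lt_one (sub_pos.2 h.2.2.1) (by linarith : l < 1)
  induction n generalizing a b a' b' with
  | zero =>
    have h1 := (centralCantor_subset h.1).1
    have h2 := (centralCantor_subset h.2.1).2
    simp only [pow_zero] at hn
    linarith
  | succ n ih =>
    have hpos : ∀ {a b}, IsBoundedGap (centralCantor l) a b → 0 ≤ a ∧ a < b ∧ b ≤ 1 :=
      fun h => ⟨(centralCantor_subset h.1).1, h.2.2.1, (centralCantor_subset h.2.1).2⟩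
    have hh := fun {a b} => gap_centralCantor_hull (a := a) (b := b) hl hl2 hlT
    rcases gap_centralCantor hl hl2 h with ⟨x, y, g, rfl, rfl⟩ | ⟨x, y, g, rfl, rfl⟩ |
      ⟨rfl, rfl⟩ <;>
    rcases gap_centralCantor hl hl2 h' with ⟨x', y', g', rfl, rfl⟩ | ⟨x', y', g', rfl, rfl⟩ |
      ⟨rfl, rfl⟩
    · rcases ih g g' (le_of_mul_le_mul_left hb hl) (by
        rw [pow_succ] at hn
        exact lt_of_mul_lt_mul_right (by linarith : l ^ n * l < (y - x) * l) hl.le) with k | k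
      · left; nlinarith
      · right; nlinarith
    · left; nlinarith [(hh g).2, (hpos g').1]
    · left; nlinarith [(hh g).2]
    · nlinarith [(hpos g).1, (hpos g).2.1, (hpos g').2.1, (hpos g').2.2]
    · rcases ih g g' (le_of_mul_le_mul_left (by linarith : l * y ≤ l * x') hl) (by
        rw [pow_succ] at hn
        exact lt_of_mul_lt_mul_right (by linarith : l ^ n * l < (y - x) * l) hl.le) with k | k
      · left; nlinarith
      · right; nlinarith
    · nlinarith [(hpos g).1, (hpos g).2.1]
    · nlinarith [(hpos g').2.1, (hpos g').2.2]
    · right; nlinarith [(hh g').1]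
    · linarith

theorem thickHull_centralCantor (hl : 0 < l) (hl2 : l < 1 / 2)
    (hlT : T * (1 - 2 * l) = l) : ThickHull (centralCantor l) 0 1 T where
  isCompact := isCompact_centralCantor
  isLeast := isLeast_centralCantor
  isGreatest := isGreatest_centralCantor
  left a b h := by rw [sub_zero]; exact (gap_centralCantor_hull hl hl2 hlT h).1
  right a b h := (gap_centralCantor_hull hl hl2 hlT h).2
  pair a b a' b' h h' hb := gap_centralCantor_pair hl hl2 hlT h h' hb

theorem exists_near_centralCantor (hl : 0 < l) (hl2 : l < 1 / 2) (n : ℕ) :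
    ∀ x ∈ centralCantor l, ∃ y ∈ centralCantor l, y ≠ x ∧ |y - x| ≤ l ^ n := by
  induction n with
  | zero =>
    intro x hx
    have h := centralCantor_subset hx
    by_cases h0 : x = 0
    · exact ⟨1, isGreatest_centralCantor.1, by rw [h0]; norm_num, by rw [h0]; norm_num⟩
    · refine ⟨0, isLeast_centralCantor.1, Ne.symm h0, ?_⟩
      rw [abs_le, pow_zero]
      constructor <;> linarith [h.1, h.2]
  | succ n ih =>
    intro x hx
    rw [centralCantor_eq hl hl2] at hx
    rcases hx with ⟨z, hz, rfl⟩ | ⟨z, hz, rfl⟩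
    all_goals
      obtain ⟨y, hy, hne, hd⟩ := ih z hz
    · refine ⟨l * y + 0, ?_, fun h => hne ?_, ?_⟩
      · rw [centralCantor_eq hl hl2]
        exact .inl ⟨y, hy, rfl⟩
      · exact mul_left_cancel₀ hl.ne' (add_right_cancel h)
      · rw [show l * y + 0 - (l * z + 0) = l * (y - z) by ring, abs_mul, abs_of_pos hl, pow_succ']
        gcongr
    · refine ⟨l * y + (1 - l), ?_, fun h => hne ?_, ?_⟩
      · rw [centralCantor_eq hl hl2]
        exact .inr ⟨y, hy, rfl⟩
      · exact mul_left_cancel₀ hl.ne' (add_right_cancel h)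
      · rw [show l * y + (1 - l) - (l * z + (1 - l)) = l * (y - z) by ring, abs_mul,
          abs_of_pos hl, pow_succ']
        gcongr

/-- An interval inside the set avoids `1 / 2`, hence lies in one piece and can be magnified by `1 /
l`. -/
theorem sub_le_of_Icc_subset (hl : 0 < l) (hl2 : l < 1 / 2) (n : ℕ) :
    ∀ s t, s ≤ t → Icc s t ⊆ centralCantor l → t - s ≤ l ^ n := by
  have split : ∀ x ∈ centralCantor l, (x ≤ l ∧ x / l ∈ centralCantor l) ∨
      (1 - l ≤ x ∧ (x - (1 - l)) / l ∈ centralCantor l) := by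
    intro x hx
    rw [centralCantor_eq hl hl2] at hx
    rcases hx with h | h <;> rw [mem_affineCopy hl] at h
    · rw [sub_zero] at h
      exact .inl ⟨(div_le_one hl).1 (centralCantor_subset h).2, h⟩
    · refine .inr ⟨?_, h⟩
      have := (centralCantor_subset h).1
      rw [le_div_iff₀ hl] at this
      linarith
  induction n with
  | zero =>
    intro s t hst h
    have h1 := centralCantor_subset (h (left_mem_Icc.2 hst))
    have h2 := centralCantor_subset (h (right_mem_Icc.2 hst))
    rw [pow_zero]
    linarith [h1.1, h2.2]
  | succ n ih =>
    intro s t hst h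
    have hhalf : ¬ (s ≤ 1 / 2 ∧ 1 / 2 ≤ t) := fun hc => by
      rcases split _ (h ⟨hc.1, hc.2⟩) with h1 | h1 <;> linarith [h1.1]
    rcases lt_or_ge t (1 / 2) with ht | ht
    · have := ih (s / l) (t / l) (by gcongr) fun x hx => by
        have h1 := (div_le_iff₀ hl).1 hx.1
        have h2 := (le_div_iff₀ hl).1 hx.2
        rcases split (x * l) (h ⟨h1, h2⟩) with h3 | h3
        · simpa [hl.ne'] using h3.2
        · linarith [h3.1]
      rw [← sub_div, div_le_iff₀ hl] at this
      rwa [pow_succ]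
    · have hs : 1 / 2 < s := by by_contra! hc; exact hhalf ⟨hc, ht⟩
      have := ih ((s - (1 - l)) / l) ((t - (1 - l)) / l) (by gcongr) fun x hx => by
        have h1 := (div_le_iff₀ hl).1 hx.1
        have h2 := (le_div_iff₀ hl).1 hx.2
        rcases split (x * l + (1 - l)) (h ⟨by linarith, by linarith⟩) with h3 | h3
        · linarith [h3.1]
        · simpa [hl.ne'] using h3.2
      rw [← sub_div, div_le_iff₀ hl] at this
      rw [pow_succ]
      linarith

theorem isCantorSet_centralCantor (hl : 0 < l) (hl2 : l < 1 / 2) :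
    IsCantorSet (centralCantor l) := by
  refine ⟨⟨0, isLeast_centralCantor.1⟩, isCompact_centralCantor,
    ⟨isCompact_centralCantor.isClosed, preperfect_iff_nhds.2 fun x hx U hU => ?_⟩, ?_⟩
  · obtain ⟨ε, hε, hU⟩ := Metric.mem_nhds_iff.1 hU
    obtain ⟨n, hn⟩ := exists_pow_lt_of_lt_one hε (by linarith : l < 1)
    obtain ⟨y, hy, hne, hd⟩ := exists_near_centralCantor hl hl2 n x hx
    exact ⟨y, ⟨hU (by rw [Metric.mem_ball, Real.dist_eq]; linarith), hy⟩, hne⟩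
  · rw [IsNowhereDense, isCompact_centralCantor.isClosed.closure_eq, eq_empty_iff_forall_notMem]
    intro x hx
    obtain ⟨ε, hε, hU⟩ := Metric.mem_nhds_iff.1 (mem_interior_iff_mem_nhds.1 hx)
    obtain ⟨n, hn⟩ := exists_pow_lt_of_lt_one (half_pos hε) (by linarith : l < 1)
    have := sub_le_of_Icc_subset hl hl2 n x (x + ε / 2) (by linarith) fun y hy => hU (by
      rw [Metric.mem_ball, Real.dist_eq, abs_lt]
      constructor <;> linarith [hy.1, hy.2])
    linarith

/-- A Cantor set with convex hull `[p, q]` and thickness at least `T`. -/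
theorem exists_thick_cantorSet (hT : 0 < T) {p q : ℝ} (hpq : p < q) :
    ∃ K, IsCantorSet K ∧ ThickHull K p q T := by
  -- The ratio `l = T / (2 * T + 1)` solves `T * (1 - 2 * l) = l`.
  have h0 : 0 < 2 * T + 1 := by positivity
  have hl : 0 < T / (2 * T + 1) := by positivity
  have hl2 : T / (2 * T + 1) < 1 / 2 := by rw [div_lt_div_iff₀ h0 two_pos]; linarith
  have hlT : T * (1 - 2 * (T / (2 * T + 1))) = T / (2 * T + 1) := by field_simp; ring
  have h := (thickHull_centralCantor hl hl2 hlT).affineCopy (sub_pos.2 hpq) (r := p)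
  refine ⟨_, (isCantorSet_centralCantor hl hl2).affineCopy (sub_pos.2 hpq) (r := p), ?_⟩
  convert h using 1 <;> ring

end

/-! ### Sets made of three blocks: thickness, product and type -/

section
variable {K A A₁ A₂ A₃ B₁ B₂ B₃ : Set ℝ} {M T P p e a B Q q f c D u v : ℝ}

theorem mul_eq_Icc_of_nonpos_left (hA : ThickHull A (-P) (-p) T) (hK : ThickHull K u v T)
    (hT : 2 ≤ T) (hp : 0 ≤ p) (hu : 0 ≤ u) (hA' : p ≤ T * (P - p)) (hK' : u ≤ T * (v - u)) :
    A * K = Icc (-(P * v)) (-(p * u)) := by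
  have hA1 := hA.neg
  rw [neg_neg, neg_neg] at hA1
  have h := mul_eq_Icc_of_nonneg hA1 hK hT hp hu hA' hK'
  rw [neg_mul, neg_eq_iff_eq_neg] at h
  rw [h, Set.neg_Icc]

theorem mul_eq_Icc_of_nonpos (hA : ThickHull A (-P) (-p) T) (hK : ThickHull K (-v) (-u) T)
    (hT : 2 ≤ T) (hp : 0 ≤ p) (hu : 0 ≤ u) (hA' : p ≤ T * (P - p)) (hK' : u ≤ T * (v - u)) :
    A * K = Icc (p * u) (P * v) := by
  have hA1 := hA.neg
  have hK1 := hK.neg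
  rw [neg_neg, neg_neg] at hA1 hK1
  rw [← mul_eq_Icc_of_nonneg hA1 hK1 hT hp hu hA' hK', neg_mul_neg]

/-- `B` is chosen so that the last block is exactly `M` times as long as the gap `(a, 1)`; every
other comparison has ratio at least `M`. -/
theorem thickness_threeBlocks (h₁ : ThickHull A₁ (-P) (-p) T) (h₂ : ThickHull A₂ e a T)
    (h₃ : ThickHull A₃ 1 B T) (hMT : M ≤ T) (hpe : 0 ≤ e + p) (ha : a < 1)
    (hl : M * (e + p) ≤ P - p) (hr : M * (e + p) ≤ a - e) (hP : M * (1 - a) ≤ a + P)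
    (hB : B = 1 + M * (1 - a)) : thickness (A₁ ∪ A₂ ∪ A₃) = M := by
  have h₁₂ : ThickHull (A₁ ∪ A₂) (-P) a M := (h₁.mono hMT).union (h₂.mono hMT) (by linarith)
    (by linarith) (by linarith)
  have h := h₁₂.union (h₃.mono hMT) ha.le (by linarith) (by linarith)
  refine h.thickness_eq (a := a) (b := 1) ⟨.inl h₁₂.isGreatest.1, .inr h₃.isLeast.1, ha, ?_⟩
    (by linarith)
  rintro x hx (hxA | hxA)
  · exact absurd hx.1 (not_lt.2 (h₁₂.isGreatest.2 hxA))
  · exact absurd hx.2 (not_lt.2 (h₃.isLeast.2 hxA))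

/-- Each of the nine block products is an interval. `A₃ * B₃` gives `[1, B * D]`; the others fill
one interval around `0`, because the smallness of `p`, `q`, `f` makes the outer ones overlap `A₂ *
B₁ = [-(a * Q), 0]` or `A₂ * B₃ = [0, a * D]`. -/
theorem mul_threeBlocks (hA₁ : ThickHull A₁ (-P) (-p) T) (hA₂ : ThickHull A₂ 0 a T)
    (hA₃ : ThickHull A₃ 1 B T) (hB₁ : ThickHull B₁ (-Q) (-q) T) (hB₂ : ThickHull B₂ f c T)
    (hB₃ : ThickHull B₃ 1 D T) (hT : 2 ≤ T) (hp : 0 ≤ p) (hq : 0 ≤ q) (hf : 0 ≤ f) (ha : 0 ≤ a) (ha1 : a ≤ 1)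
    (hpP : p ≤ P) (hqQ : q ≤ Q) (hfc : f ≤ c) (hc1 : c ≤ 1) (h1B : 1 ≤ B) (h1D : 1 ≤ D)
    (kP : p ≤ T * (P - p)) (kB : 1 ≤ T * (B - 1)) (kQ : q ≤ T * (Q - q))
    (kc : f ≤ T * (c - f)) (kD : 1 ≤ T * (D - 1))
    (hfa : f ≤ a * D) (hpq : p * q ≤ a * D) (hqa : q ≤ a * Q) (hpa : p ≤ a * Q) :
    (A₁ ∪ A₂ ∪ A₃) * (B₁ ∪ B₂ ∪ B₃) =
      Icc (-max (B * Q) (P * D)) (max (max (a * D) (B * c)) (P * Q)) ∪ Icc 1 (B * D) := by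
  have ka : 0 ≤ T * (a - 0) := by rw [sub_zero]; positivity
  have e₁₁ := mul_eq_Icc_of_nonpos hA₁ hB₁ hT hp hq kP kQ
  have e₁₂ := mul_eq_Icc_of_nonpos_left hA₁ hB₂ hT hp hf kP kc
  have e₁₃ := mul_eq_Icc_of_nonpos_left hA₁ hB₃ hT hp zero_le_one kP kD
  have e₂₁ := mul_eq_Icc_of_nonpos_left hB₁ hA₂ hT hq le_rfl kQ ka
  have e₂₂ := mul_eq_Icc_of_nonneg hA₂ hB₂ hT le_rfl hf ka kc
  have e₂₃ := mul_eq_Icc_of_nonneg hA₂ hB₃ hT le_rfl zero_le_one ka kD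
  have e₃₁ := mul_eq_Icc_of_nonpos_left hB₁ hA₃ hT hq zero_le_one kQ kB
  have e₃₂ := mul_eq_Icc_of_nonneg hA₃ hB₂ hT zero_le_one hf kB kc
  have e₃₃ := mul_eq_Icc_of_nonneg hA₃ hB₃ hT zero_le_one zero_le_one kB kD
  rw [union_mul, union_mul, mul_union, mul_union, mul_union, mul_union, mul_union, mul_union,
    e₁₁, e₁₂, e₁₃, mul_comm A₂ B₁, e₂₁, e₂₂, e₂₃, mul_comm A₃ B₁, e₃₁, e₃₂, e₃₃]
  have hP : 0 ≤ P := hp.trans hpP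
  have hQ : 0 ≤ Q := hq.trans hqQ
  have hc : 0 ≤ c := hf.trans hfc
  simp only [mul_one, one_mul, mul_zero, zero_mul, neg_zero]
  have b0 : 0 ≤ B * Q := by positivity
  have b1 : P * c ≤ P * D := by gcongr; linarith
  have b2 : a * Q ≤ B * Q := by gcongr; linarith
  have b3 : a * c ≤ a * D := by gcongr; linarith
  have b4 : 0 ≤ a * D := by positivity
  have b5 : 0 ≤ p * q := by positivity
  have b6 : 0 ≤ p * f := by positivity
  have b7 : P * D ≤ max (B * Q) (P * D) := le_max_right _ _
  have b8 : B * Q ≤ max (B * Q) (P * D) := le_max_left _ _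
  have b9 : a * D ≤ max (max (a * D) (B * c)) (P * Q) := (le_max_left _ _).trans (le_max_left _ _)
  have b10 : B * c ≤ max (max (a * D) (B * c)) (P * Q) :=
    (le_max_right _ _).trans (le_max_left _ _)
  have b11 : P * Q ≤ max (max (a * D) (B * c)) (P * Q) := le_max_right _ _
  apply Subset.antisymm
  · refine union_subset (union_subset (union_subset (union_subset ?_ ?_) ?_)
      (union_subset (union_subset ?_ ?_) ?_)) (union_subset (union_subset ?_ ?_)
      subset_union_right) <;>
    · exact subset_union_of_subset_left (Icc_subset_Icc (by linarith) (by linarith)) _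
  · rintro z (⟨hz1, hz2⟩ | hz)
    · rcases le_total z 0 with hz0 | hz0
      · by_cases h21 : -(a * Q) ≤ z
        · exact .inl (.inr (.inl (.inl ⟨by linarith, hz0⟩)))
        rw [neg_le, le_max_iff] at hz1
        rcases hz1 with hz1 | hz1
        · exact .inr (.inl (.inl ⟨by linarith, by linarith⟩))
        · exact .inl (.inl (.inr ⟨by linarith, by linarith⟩))
      · by_cases h23 : z ≤ a * D
        · exact .inl (.inr (.inr ⟨hz0, h23⟩))
        rw [le_max_iff, le_max_iff] at hz2
        rcases hz2 with (hz2 | hz2) | hz2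
        · exact absurd hz2 h23
        · exact .inr (.inl (.inr ⟨by linarith, hz2⟩))
        · exact .inl (.inl (.inl (.inl ⟨by linarith, hz2⟩)))
    · exact .inr (.inr hz)

theorem sInf_plusPart_eq_zero (hA : IsCantorSet A) (hAK : A ⊆ K) (h : IsLeast A 0) :
    (plusPart K).Nonempty ∧ sInf (plusPart K) = 0 := by
  have near : ∀ ε > 0, ∃ y ∈ plusPart K, y < ε := by
    intro ε hε
    obtain ⟨y, hy, hne⟩ := preperfect_iff_nhds.1 hA.perfect.acc 0 h.1 (Iio ε) (Iio_mem_nhds hε)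
    exact ⟨y, ⟨hAK hy.2, lt_of_le_of_ne (h.2 hy.2) hne.symm⟩, hy.1⟩
  have hnn : ∀ y ∈ plusPart K, 0 ≤ y := fun y hy => le_of_lt hy.2
  refine ⟨let ⟨y, hy, _⟩ := near 1 one_pos; ⟨y, hy⟩,
    le_antisymm (le_of_forall_pos_le_add fun ε hε => ?_) (Real.sInf_nonneg hnn)⟩
  obtain ⟨y, hy, hlt⟩ := near ε hε
  linarith [csInf_le ⟨0, hnn⟩ hy]

theorem sInf_minusPart_eq_zero (hA : IsCantorSet A) (hAK : A ⊆ K) (h : IsGreatest A 0) :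
    (minusPart K).Nonempty ∧ sInf (minusPart K) = 0 := by
  have near : ∀ ε > 0, ∃ y ∈ minusPart K, y < ε := by
    intro ε hε
    obtain ⟨y, hy, hne⟩ := preperfect_iff_nhds.1 hA.perfect.acc 0 h.1 (Ioi (-ε))
      (Ioi_mem_nhds (by linarith))
    refine ⟨-y, ⟨?_, ?_⟩, by linarith [show -ε < y from hy.1]⟩
    · rw [neg_neg]; exact hAK hy.2
    · rw [neg_neg]; exact lt_of_le_of_ne (h.2 hy.2) hne
  have hnn : ∀ y ∈ minusPart K, 0 ≤ y := fun y hy => by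
    have : -y < 0 := hy.2
    linarith
  refine ⟨let ⟨y, hy, _⟩ := near 1 one_pos; ⟨y, hy⟩,
    le_antisymm (le_of_forall_pos_le_add fun ε hε => ?_) (Real.sInf_nonneg hnn)⟩
  obtain ⟨y, hy, hlt⟩ := near ε hε
  linarith [csInf_le ⟨0, hnn⟩ hy]

theorem isZeroCantor_threeBlocks (c₁ : IsCantorSet A₁) (c₂ : IsCantorSet A₂)
    (c₃ : IsCantorSet A₃) (h₁ : IsGreatest A₁ 0) (h₂ : IsLeast A₂ 0) :
    IsZeroCantor (A₁ ∪ A₂ ∪ A₃) := by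
  obtain ⟨n1, z1⟩ := sInf_plusPart_eq_zero (K := A₁ ∪ A₂ ∪ A₃) c₂ (fun x hx => .inl (.inr hx)) h₂
  obtain ⟨n2, z2⟩ := sInf_minusPart_eq_zero (K := A₁ ∪ A₂ ∪ A₃) c₁ (fun x hx => .inl (.inl hx)) h₁
  exact ⟨(c₁.union c₂).union c₃, n1, n2, z1, z2⟩

theorem minusPart_threeBlocks (h₁ : IsGreatest A₁ (-p)) (hp : 0 < p) (h₂ : ∀ x ∈ A₂, 0 ≤ x)
    (h₃ : ∀ x ∈ A₃, 0 ≤ x) :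
    (minusPart (A₁ ∪ A₂ ∪ A₃)).Nonempty ∧ 0 < sInf (minusPart (A₁ ∪ A₂ ∪ A₃)) := by
  have hne : (minusPart (A₁ ∪ A₂ ∪ A₃)).Nonempty :=
    ⟨p, .inl (.inl h₁.1), neg_neg_of_pos hp⟩
  refine ⟨hne, hp.trans_le (le_csInf hne ?_)⟩
  rintro y ⟨(hy | hy) | hy, hy0⟩
  · linarith [h₁.2 hy]
  · exact absurd (h₂ _ hy) (not_le.2 hy0)
  · exact absurd (h₃ _ hy) (not_le.2 hy0)

theorem isZeroPlusMinusCantor_threeBlocks (c₁ : IsCantorSet A₁) (c₂ : IsCantorSet A₂)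
    (c₃ : IsCantorSet A₃) (h₁ : IsGreatest A₁ (-p)) (hp : 0 < p) (h₂ : IsLeast A₂ 0)
    (h₃ : IsLeast A₃ 1) : IsZeroPlusMinusCantor (A₁ ∪ A₂ ∪ A₃) := by
  obtain ⟨n1, z1⟩ := sInf_plusPart_eq_zero (K := A₁ ∪ A₂ ∪ A₃) c₂ (fun x hx => .inl (.inr hx)) h₂
  obtain ⟨n2, z2⟩ := minusPart_threeBlocks h₁ hp h₂.2 fun x hx => zero_le_one.trans (h₃.2 hx)
  exact ⟨(c₁.union c₂).union c₃, n1, n2, z1, z2⟩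

theorem isZeroTimesCantor_threeBlocks (c₁ : IsCantorSet A₁) (c₂ : IsCantorSet A₂)
    (c₃ : IsCantorSet A₃) (h₁ : IsGreatest A₁ (-p)) (hp : 0 < p) (he : 0 < e)
    (h₂ : IsLeast A₂ e) (h₃ : IsLeast A₃ 1) : IsZeroTimesCantor (A₁ ∪ A₂ ∪ A₃) := by
  obtain ⟨n2, -⟩ := minusPart_threeBlocks h₁ hp (fun x hx => he.le.trans (h₂.2 hx))
    fun x hx => zero_le_one.trans (h₃.2 hx)
  refine ⟨(c₁.union c₂).union c₃, ⟨1, .inr h₃.1, zero_lt_one' ℝ⟩, n2, ?_⟩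
  rintro ((h | h) | h)
  · linarith [h₁.2 h]
  · linarith [h₂.2 h]
  · linarith [h₃.2 h]

end

/-! ### Choice of the parameters; part (b) -/

theorem eventually_pos_of_continuousAt {g : ℝ → ℝ} (hg : ContinuousAt g 0) (h : 0 < g 0) :
    ∀ᶠ x in 𝓝[>] (0 : ℝ), 0 < g x :=
  (hg.eventually_const_lt h).filter_mono nhdsWithin_le_nhds

/-- Reduction of the choice of the blocks to the choice of the reciprocal gap ratios `X`, `Y`. -/
theorem exists_params_of_ratios {M N X Y P Q : ℝ} (hX : 1 < X) (hY : 1 < Y)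
    (h1 : N * X - Y < N) (h2 : M * Y - X < M) (hP : 0 < P) (hQ : 0 < Q)
    (hPX : (M + 1) * (1 / X) - 1 ≤ P) (hQY : (N + 1) * (1 / Y) - 1 ≤ Q) (hPQ : P * Q < 1) :
    ∃ a c P Q : ℝ, 0 < a ∧ a < 1 ∧ 0 < c ∧ c < 1 ∧ 0 < P ∧ 0 < Q ∧
      M * (1 - a) ≤ a + P ∧ N * (1 - c) ≤ c + Q ∧ a * (1 + N * (1 - c)) < 1 ∧
      (1 + M * (1 - a)) * c < 1 ∧ P * Q < 1 := by
  have hX0 : 0 < X := by linarith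
  have hY0 : 0 < Y := by linarith
  have hXY : 0 < X * Y := by positivity
  have iX : 1 / X < 1 := (div_lt_one hX0).2 hX
  have iY : 1 / Y < 1 := (div_lt_one hY0).2 hY
  have jX : 0 < 1 / X := by positivity
  have jY : 0 < 1 / Y := by positivity
  -- With `1 - a = 1 / X` and `1 - c = 1 / Y`, the conditions on `a` and `c` become linear in `X`
  -- and `Y`.
  refine ⟨1 - 1 / X, 1 - 1 / Y, P, Q, by linarith, by linarith, by linarith, by linarith, hP, hQ,
    by linarith, by linarith, ?_, ?_, hPQ⟩
  · have : (1 - 1 / X) * (1 + N * (1 - (1 - 1 / Y))) = 1 - (Y + N - N * X) / (X * Y) := by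
      field_simp; ring
    rw [this]
    have : 0 < (Y + N - N * X) / (X * Y) := div_pos (by linarith) hXY
    linarith
  · have : (1 + M * (1 - (1 - 1 / X))) * (1 - 1 / Y) = 1 - (X + M - M * Y) / (X * Y) := by
      field_simp; ring
    rw [this]
    have : 0 < (X + M - M * Y) / (X * Y) := div_pos (by linarith) hXY
    linarith

/-- For `M * N > 1`, take `X`, `Y` with equality in both linear constraints. The requirement that
the least admissible `P`, `Q` have product below `1` then amounts to `h` when both are positive, and
strictness leaves room for a perturbation. -/
theorem exists_params {M N : ℝ} (hM : 0 < M) (hN : 0 < N)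
    (h : (M * N - 1) ^ 2 < 2 * (M + 1) * (N + 1)) :
    ∃ a c P Q : ℝ, 0 < a ∧ a < 1 ∧ 0 < c ∧ c < 1 ∧ 0 < P ∧ 0 < Q ∧
      M * (1 - a) ≤ a + P ∧ N * (1 - c) ≤ c + Q ∧ a * (1 + N * (1 - c)) < 1 ∧
      (1 + M * (1 - a)) * c < 1 ∧ P * Q < 1 := by
  rcases le_or_gt (M * N) 1 with hMN | hMN
  · have hYe : (M * (N + 1) + M + 1) / M = N + 1 + 1 + 1 / M := by field_simp
    have hM1 : N ≤ 1 / M := by rw [le_div_iff₀ hM]; linarith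
    have hMM : M * (1 / M) = 1 := by field_simp
    -- Here `Y = X / M + 1 / 2`; both constraints follow from `M * N ≤ 1`, and the lower bounds on
    -- `P` and `Q` are at most `0`.
    refine exists_params_of_ratios (X := M * (N + 1) + M + 1) (Y := N + 1 + 1 + 1 / M + 1 / 2)
      (P := 1 / 2) (Q := 1 / 2) (by nlinarith) (by linarith) (by nlinarith) (by nlinarith)
      (by norm_num) (by norm_num) ?_ ?_ (by norm_num)
    · have : (M + 1) * (1 / (M * (N + 1) + M + 1)) ≤ 1 := by
        rw [mul_one_div, div_le_one (by positivity)]; nlinarith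
      linarith
    · have : (N + 1) * (1 / (N + 1 + 1 + 1 / M + 1 / 2)) ≤ 1 := by
        rw [mul_one_div, div_le_one (by positivity)]
        have : 0 < 1 / M := by positivity
        linarith
      linarith
  · have k : 0 < M * N - 1 := by linarith
    set X := M * (N + 1) / (M * N - 1) with hX
    set Y := N * (M + 1) / (M * N - 1) with hY
    have hX1 : 1 < X := by rw [hX, one_lt_div k]; linarith
    have hY1 : 1 < Y := by rw [hY, one_lt_div k]; linarith
    have eX : X * (M * N - 1) = M * (N + 1) := by rw [hX, div_mul_cancel₀ _ k.ne']
    have eY : Y * (M * N - 1) = N * (M + 1) := by rw [hY, div_mul_cancel₀ _ k.ne']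
    have e1 : N * X - Y = N := by
      apply mul_right_cancel₀ k.ne'; linear_combination N * eX - eY
    have e2 : M * Y - X = M := by
      apply mul_right_cancel₀ k.ne'; linear_combination M * eY - eX
    have hX0 : X ≠ 0 := by positivity
    have hY0 : Y ≠ 0 := by positivity
    have key : (M + 1) * (N + 1) < (N + 1) * X + (M + 1) * Y := by
      apply lt_of_mul_lt_mul_right _ k.le
      have : ((N + 1) * X + (M + 1) * Y) * (M * N - 1) =
          (N + 1) * (M * (N + 1)) + (M + 1) * (N * (M + 1)) := by
        linear_combination (N + 1) * eX + (M + 1) * eY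
      rw [this]
      nlinarith
    have hprod : ((M + 1) * (1 / X) - 1) * ((N + 1) * (1 / Y) - 1) < 1 := by
      have : ((M + 1) * (1 / X) - 1) * ((N + 1) * (1 / Y) - 1) =
          1 - ((N + 1) * X + (M + 1) * Y - (M + 1) * (N + 1)) / (X * Y) := by
        field_simp; ring
      rw [this]
      have : 0 < ((N + 1) * X + (M + 1) * Y - (M + 1) * (N + 1)) / (X * Y) :=
        div_pos (by linarith) (by positivity)
      linarith
    have hmax : max ((M + 1) * (1 / X) - 1) 0 * max ((N + 1) * (1 / Y) - 1) 0 < 1 := by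
      rcases le_total ((M + 1) * (1 / X) - 1) 0 with i | i
      · rw [max_eq_right i, zero_mul]; exact one_pos
      rcases le_total ((N + 1) * (1 / Y) - 1) 0 with j | j
      · rw [max_eq_right j, mul_zero]; exact one_pos
      · rwa [max_eq_left i, max_eq_left j]
    -- Moving `(X, Y)` by `-δ * (M + 1, N + 1)` lowers both `N * X - Y` and `M * Y - X` by `δ * (M *
    -- N - 1)`, making both constraints strict. The maximum with `δ` keeps `P` and `Q` positive.
    have f1 := eventually_pos_of_continuousAt (g := fun δ => X - δ * (M + 1) - 1) (by fun_prop)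
      (by simp; exact hX1)
    have f2 := eventually_pos_of_continuousAt (g := fun δ => Y - δ * (N + 1) - 1) (by fun_prop)
      (by simp; exact hY1)
    have f3 := eventually_pos_of_continuousAt (g := fun δ =>
      1 - max ((M + 1) * (1 / (X - δ * (M + 1))) - 1) δ *
        max ((N + 1) * (1 / (Y - δ * (N + 1))) - 1) δ)
      (by
        have : X - 0 * (M + 1) ≠ 0 := by simpa using hX0
        have : Y - 0 * (N + 1) ≠ 0 := by simpa using hY0
        fun_prop (disch := assumption))
      (by simpa using hmax)
    obtain ⟨δ, ⟨⟨g1, g2⟩, g3⟩, hδ⟩ :=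
      (((f1.and f2).and f3).and self_mem_nhdsWithin).exists
    have hδ : 0 < δ := hδ
    exact exists_params_of_ratios (X := X - δ * (M + 1)) (Y := Y - δ * (N + 1))
      (by linarith) (by linarith)
      (by nlinarith [mul_pos hδ k]) (by nlinarith [mul_pos hδ k])
      (hδ.trans_le (le_max_right _ _)) (hδ.trans_le (le_max_right _ _)) (le_max_left _ _)
      (le_max_left _ _) (by linarith)

/-- A common choice of blocks for all sufficiently small gaps `(-p, 0)` and `(-q, f)` around `0`. -/
theorem exists_blocks {M N : ℝ} (hM : 0 < M) (hN : 0 < N)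
    (h : (M * N - 1) ^ 2 < 2 * (M + 1) * (N + 1)) :
    ∃ ε > 0, ∀ p ∈ Icc 0 ε, ∀ q ∈ Icc 0 ε, ∀ f ∈ Icc 0 ε, ∃ A₁ A₂ A₃ B₁ B₂ B₃ : Set ℝ,
      (IsCantorSet A₁ ∧ IsCantorSet A₂ ∧ IsCantorSet A₃) ∧
      (IsGreatest A₁ (-p) ∧ IsLeast A₂ 0 ∧ IsLeast A₃ 1) ∧
      (IsCantorSet B₁ ∧ IsCantorSet B₂ ∧ IsCantorSet B₃) ∧
      (IsGreatest B₁ (-q) ∧ IsLeast B₂ f ∧ IsLeast B₃ 1) ∧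
      thickness (A₁ ∪ A₂ ∪ A₃) = M ∧ thickness (B₁ ∪ B₂ ∪ B₃) = N ∧
      ∃ a b c d : ℝ, a < b ∧ b < c ∧ c < d ∧
        (A₁ ∪ A₂ ∪ A₃) * (B₁ ∪ B₂ ∪ B₃) = Icc a b ∪ Icc c d := by
  obtain ⟨a, c, P, Q, ha, ha1, hc, hc1, hP, hQ, hPa, hQc, haD, hBc, hPQ⟩ := exists_params hM hN h
  have hD : 0 < N * (1 - c) := mul_pos hN (sub_pos.2 hc1)
  have hB : 0 < M * (1 - a) := mul_pos hM (sub_pos.2 ha1)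
  have haQ : 0 < a * Q := mul_pos ha hQ
  have small : ∀ {r : ℝ} (s : ℝ), 0 < r → ∀ᶠ ε in 𝓝[>] (0 : ℝ), 0 < r - s * ε := fun s hr =>
    eventually_pos_of_continuousAt (by fun_prop) (by simpa using hr)
  obtain ⟨ε, ⟨⟨⟨⟨⟨⟨e1, e2⟩, e3⟩, e4⟩, e5⟩, e6⟩, e7⟩, hε⟩ :=
    (((((((small (M + 1) hP).and (small M ha)).and (small (2 * N + 1) hQ)).and
    (small (2 * N + 1) hc)).and (small 1 ha)).and (small 1 haQ)).and (small 1 one_pos)).and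
    self_mem_nhdsWithin |>.exists
  have hε : 0 < ε := hε
  refine ⟨ε, hε, ?_⟩
  rintro p ⟨hp, hpε⟩ q ⟨hq, hqε⟩ f ⟨hf, hfε⟩
  have hMp : M * p ≤ M * ε := by gcongr
  have hNq : N * q ≤ N * ε := by gcongr
  have hNf : N * f ≤ N * ε := by gcongr
  have hMε : 0 ≤ M * ε := by positivity
  have hNε : 0 ≤ N * ε := by positivity
  have hpP : p < P := by linarith
  have hqQ : q < Q := by linarith
  have hfc : f < c := by linarith
  have big : ∀ {r : ℝ} (s : ℝ), 0 < r → ∀ᶠ T in atTop, s ≤ T * r := fun s hr =>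
    (tendsto_id.atTop_mul_const hr).eventually_ge_atTop s
  -- The block thickness `T` is chosen last, depending on `p`, `q`, `f`: it must exceed the
  -- thicknesses sought and satisfy the hypotheses of the one-sided gap lemma.
  obtain ⟨T, ⟨⟨⟨⟨⟨⟨⟨t1, t2⟩, t3⟩, t4⟩, t5⟩, t6⟩, t7⟩, t8⟩⟩ :=
    (((((((eventually_ge_atTop 2).and (eventually_ge_atTop M)).and
    (eventually_ge_atTop N)).and (big p (sub_pos.2 hpP))).and (big 1 hB)).and
    (big q (sub_pos.2 hqQ))).and (big f (sub_pos.2 hfc))).and (big 1 hD) |>.exists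
  have hT : 0 < T := by linarith
  obtain ⟨A₁, cA₁, hA₁⟩ := exists_thick_cantorSet hT (neg_lt_neg hpP)
  obtain ⟨A₂, cA₂, hA₂⟩ := exists_thick_cantorSet hT ha
  obtain ⟨A₃, cA₃, hA₃⟩ := exists_thick_cantorSet hT (by linarith : 1 < 1 + M * (1 - a))
  obtain ⟨B₁, cB₁, hB₁⟩ := exists_thick_cantorSet hT (neg_lt_neg hqQ)
  obtain ⟨B₂, cB₂, hB₂⟩ := exists_thick_cantorSet hT hfc
  obtain ⟨B₃, cB₃, hB₃⟩ := exists_thick_cantorSet hT (by linarith : 1 < 1 + N * (1 - c))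
  have haD' : a ≤ a * (1 + N * (1 - c)) := le_mul_of_one_le_right ha.le (by linarith)
  have hpq : p * q ≤ ε :=
    (mul_le_mul (by linarith : p ≤ 1) hqε hq zero_le_one).trans_eq (one_mul ε)
  refine ⟨A₁, A₂, A₃, B₁, B₂, B₃, ⟨cA₁, cA₂, cA₃⟩,
    ⟨hA₁.isGreatest, hA₂.isLeast, hA₃.isLeast⟩, ⟨cB₁, cB₂, cB₃⟩,
    ⟨hB₁.isGreatest, hB₂.isLeast, hB₃.isLeast⟩,
    thickness_threeBlocks hA₁ hA₂ hA₃ t2 (by linarith) ha1 (by linarith) (by linarith) hPa rfl,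
    thickness_threeBlocks hB₁ hB₂ hB₃ t3 (by linarith) hc1 (by linarith) (by linarith) hQc rfl,
    _, _, _, _, ?_, ?_, ?_,
    mul_threeBlocks hA₁ hA₂ hA₃ hB₁ hB₂ hB₃ t1 hp hq hf ha.le ha1.le hpP.le hqQ.le hfc.le hc1.le
      (by linarith) (by linarith) t4 (by linarith) t6 t7 (by linarith) (by linarith) (by linarith)
      (by linarith) (by linarith)⟩
  · have h1 : 0 < (1 + M * (1 - a)) * Q := by positivity
    have h2 : 0 < a * (1 + N * (1 - c)) := by positivity
    have h3 := h1.trans_le (le_max_left _ (P * (1 + N * (1 - c))))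
    have h4 := h2.trans_le ((le_max_left _ ((1 + M * (1 - a)) * c)).trans (le_max_left _ (P * Q)))
    linarith
  · exact max_lt (max_lt haD hBc) hPQ
  · exact one_lt_mul_of_lt_of_le (by linarith) (by linarith)

/-- The type is decided by which of `p`, `q`, `f` are `0` and which are `ε`: `p = 0` makes `K`
accumulate at `0` from both sides, and `f = ε` together with `q = ε` removes `0` from `L`. -/
theorem PairType.exists_two_Icc (t : PairType) {M N : ℝ} (hM : 0 < M) (hN : 0 < N)
    (h : (M * N - 1) ^ 2 < 2 * (M + 1) * (N + 1)) :
    ∃ K L : Set ℝ, t.Holds K L ∧ thickness K = M ∧ thickness L = N ∧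
      ∃ a b c d : ℝ, a < b ∧ b < c ∧ c < d ∧ K * L = Icc a b ∪ Icc c d := by
  obtain ⟨ε, hε, H⟩ := exists_blocks hM hN h
  have h0 : (0 : ℝ) ∈ Icc 0 ε := ⟨le_rfl, hε.le⟩
  have h1 : ε ∈ Icc 0 ε := ⟨hε.le, le_rfl⟩
  cases t
  · obtain ⟨A₁, A₂, A₃, B₁, B₂, B₃, ⟨a₁, a₂, a₃⟩, ⟨l₁, l₂, -⟩, ⟨b₁, b₂, b₃⟩, ⟨m₁, m₂, m₃⟩, k⟩ :=
      H 0 h0 ε h1 0 h0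
    rw [neg_zero] at l₁
    exact ⟨_, _, ⟨isZeroCantor_threeBlocks a₁ a₂ a₃ l₁ l₂,
      isZeroPlusMinusCantor_threeBlocks b₁ b₂ b₃ m₁ hε m₂ m₃⟩, k⟩
  · obtain ⟨A₁, A₂, A₃, B₁, B₂, B₃, ⟨a₁, a₂, a₃⟩, ⟨l₁, l₂, -⟩, ⟨b₁, b₂, b₃⟩, ⟨m₁, m₂, m₃⟩, k⟩ :=
      H 0 h0 ε h1 ε h1
    rw [neg_zero] at l₁
    exact ⟨_, _, ⟨isZeroCantor_threeBlocks a₁ a₂ a₃ l₁ l₂,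
      isZeroTimesCantor_threeBlocks b₁ b₂ b₃ m₁ hε hε m₂ m₃⟩, k⟩
  · obtain ⟨A₁, A₂, A₃, B₁, B₂, B₃, ⟨a₁, a₂, a₃⟩, ⟨l₁, l₂, l₃⟩, ⟨b₁, b₂, b₃⟩, ⟨m₁, m₂, m₃⟩, k⟩ :=
      H ε h1 ε h1 ε h1
    exact ⟨_, _, ⟨isZeroPlusMinusCantor_threeBlocks a₁ a₂ a₃ l₁ hε l₂ l₃,
      isZeroTimesCantor_threeBlocks b₁ b₂ b₃ m₁ hε hε m₂ m₃⟩, k⟩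
  · obtain ⟨A₁, A₂, A₃, B₁, B₂, B₃, ⟨a₁, a₂, a₃⟩, ⟨l₁, l₂, l₃⟩, ⟨b₁, b₂, b₃⟩, ⟨m₁, m₂, m₃⟩, k⟩ :=
      H ε h1 ε h1 0 h0
    exact ⟨_, _, ⟨isZeroPlusMinusCantor_threeBlocks a₁ a₂ a₃ l₁ hε l₂ l₃,
      isZeroPlusMinusCantor_threeBlocks b₁ b₂ b₃ m₁ hε m₂ m₃⟩, k⟩

end CantorProduct

theorem mainTheorem6 (t : CantorProduct.PairType) :
    (∀ K L : Set ℝ, t.Holds K L →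
      2 * (CantorProduct.thickness K + 1) * (CantorProduct.thickness L + 1)
        ≤ (CantorProduct.thickness K * CantorProduct.thickness L - 1) ^ 2 →
      ∃ a b : ℝ, a < b ∧ K * L = Icc a b) ∧
    (∀ M N : ℝ, 0 < M → 0 < N →
      (M * N - 1) ^ 2 < 2 * (M + 1) * (N + 1) →
      ∃ K L : Set ℝ, t.Holds K L ∧
        CantorProduct.thickness K = M ∧ CantorProduct.thickness L = N ∧
        ∃ a b c d : ℝ, a < b ∧ b < c ∧ c < d ∧ K * L = Icc a b ∪ Icc c d) := by
  exact ⟨fun K L h hc => h.exists_Icc hc, fun M N hM hN h => t.exists_two_Icc hM hN h⟩
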